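/- Let $s\in[-\tfrac12,1]$ be a fixed non-zero constant. For $n\in\mathbb{S}^2\subset\mathbb{R}^3$ put $P(n)=s\left(n\otimes n-\tfrac13\,\mathrm{Id}\right)$, and let $\boldsymbol{\mathcal{Q}}=\{P(n): n\in\mathbb{S}^2\}$, a set of real $3\times 3$ matrices. For an open set $\Omega\subset\mathbb{R}^d$, $1\le p\le\infty$ and $N\subset\mathbb{R}^l$, let $W^{1,p}(\Omega,N)$ be the set of $f\in W^{1,p}(\Omega,\mathbb{R}^l)$ with $f(x)\in N$ for a.e. $x\in\Omega$ (with $3\times3$ matrices regarded as elements of $\mathbb{R}^9$). A map $Q\in W^{1,p}(\Omega,\boldsymbol{\mathcal{Q}})$ is called orientable if there is an $n\in W^{1,p}(\Omega,\mathbb{S}^2)$ with $P(n)=Q$ a.e. in $\Omega$. Let $\Omega\subset\mathbb{R}^d$ be a bounded domain (a bounded, open, connected set) with boundary of class $C^0$: for every $x\in\partial\Omega$ there are $\delta>0$, an orthonormal coordinate system $y=(y',y_d)$ with origin at $x$ and a continuous function $f:\mathbb{R}^{d-1}\to\mathbb{R}$ such that $\{y\in\Omega:|y|<\delta\}=\{y\in\mathbb{R}^d: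 y_d>f(y'),\ |y|<\delta\}$. **Proposition.** Let $1\le p\le\infty$ and let $Q^{(k)}\in W^{1,p}(\Omega,\boldsymbol{\mathcal{Q}})$, $k\in\mathbb{N}$, be a sequence of orientable maps. Suppose that $Q^{(k)}$ converges to $Q$ weakly in $W^{1,p}(\Omega,\mathbb{R}^9)$ if $p<\infty$, respectively weakly* in $W^{1,\infty}(\Omega,\mathbb{R}^9)$ if $p=\infty$ (that is, $Q^{(k)}$ and each of its first-order weak partial derivatives converge weakly* in $L^\infty(\Omega,\mathbb{R}^9)$ to $Q$ and its corresponding derivative). Then $Q\in W^{1,p}(\Omega,\boldsymbol{\mathcal{Q}})$ and $Q$ is orientable, i.e. $Q=P(n)$ a.e. in $\Omega$ for some $n\in W^{1,p}(\Omega,\mathbb{S}^2)$. -/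

import Mathlib

open MeasureTheory Filter Topology Set
open scoped ENNReal ContDiff

noncomputable section

namespace LineField

/-- `ℝᵈ` with its Euclidean norm. -/
abbrev Eu (d : ℕ) : Type := EuclideanSpace ℝ (Fin d)

/-- `ℝ⁹`, the space of real `3 × 3` matrices with the Frobenius (Euclidean) norm;
the `(i, j)` coordinate is the `(i, j)` entry. -/
abbrev Mat9 : Type := EuclideanSpace ℝ (Fin 3 × Fin 3)

/-- A point of `ℝ⁹` read as a `3 × 3` matrix. -/
def asMatrix (q : Mat9) : Matrix (Fin 3) (Fin 3) ℝ := Matrix.of fun i j => q (i, j)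

/-- The unit sphere `𝕊²` of `ℝ³`. -/
def sphere2 : Set (Eu 3) := Metric.sphere 0 1

/-- `P(n) = s (n ⊗ n - Id / 3)`. -/
def projP (s : ℝ) (n : Eu 3) : Matrix (Fin 3) (Fin 3) ℝ :=
  s • (Matrix.vecMulVec n n - (1 / 3 : ℝ) • (1 : Matrix (Fin 3) (Fin 3) ℝ))

/-- The set of uniaxial matrices with scalar order parameter `s`. -/
def lineSet (s : ℝ) : Set (Matrix (Fin 3) (Fin 3) ℝ) :=
  {A | ∃ n ∈ sphere2, A = projP s n}

/-- A set of class `C⁰`: near every boundary point `x`, in orthonormal coordinates `y` centred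
at `x` with a distinguished coordinate `y_m`, the set is the strict epigraph `y_m > f(y')` of a
continuous function `f` of the remaining `d - 1` coordinates `y'`. -/
def HasC0Boundary {d : ℕ} (Ω : Set (Eu d)) : Prop :=
  ∀ x ∈ frontier Ω, ∃ δ : ℝ, 0 < δ ∧
    ∃ (b : OrthonormalBasis (Fin d) ℝ (Eu d)) (m : Fin d) (f : ({j : Fin d // j ≠ m} → ℝ) → ℝ),
      Continuous f ∧
      ∀ z : Eu d, dist z x < δ →
        (z ∈ Ω ↔ f (fun j => b.repr (z - x) j) < b.repr (z - x) m)

section Sobolev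

variable {d : ℕ} {F : Type*} [NormedAddCommGroup F] [NormedSpace ℝ F]

/-- `g` is the weak partial derivative `∂u/∂xᵢ` on `Ω`. -/
def IsWeakPartial (Ω : Set (Eu d)) (i : Fin d) (u g : Eu d → F) : Prop :=
  ∀ φ : Eu d → ℝ, ContDiff ℝ ∞ φ → HasCompactSupport φ → tsupport φ ⊆ Ω →
    ∫ x in Ω, fderiv ℝ φ x (EuclideanSpace.single i 1) • u x = -∫ x in Ω, φ x • g x

theorem integrable_test_smul {μ : Measure (Eu d)} [IsFiniteMeasureOnCompacts μ]
    {p : ℝ≥0∞} [hp : Fact (1 ≤ p)] {φ : Eu d → ℝ}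
    (hφ : Continuous φ) (hc : HasCompactSupport φ) {u : Eu d → F} (hu : MemLp u p μ) :
    Integrable (fun x => φ x • u x) μ := by
  have hul : LocallyIntegrable u μ := hu.locallyIntegrable hp.out
  exact hul.integrable_smul_left_of_hasCompactSupport hφ hc

/-- `W^{1,p}(Ω, F)`, an element being a function in `L^p(Ω, F)` together with its weak partial
derivatives, which lie in `L^p(Ω, F)` too and are determined by the function. The norm inherited
from the product, the largest of `‖u‖_p, ‖∂₁u‖_p, …, ‖∂_d u‖_p`, is equivalent to the usual one. -/
def W1p (Ω : Set (Eu d)) (p : ℝ≥0∞) [Fact (1 ≤ p)] (F : Type*) [NormedAddCommGroup F]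
    [NormedSpace ℝ F] :
    Submodule ℝ (Lp F p (volume.restrict Ω) × (Fin d → Lp F p (volume.restrict Ω))) where
  carrier := {U | ∀ i, IsWeakPartial Ω i U.1 (U.2 i)}
  zero_mem' := by
    intro i φ _ _ _
    have h : ((0 : Lp F p (volume.restrict Ω)) : Eu d → F) =ᵐ[volume.restrict Ω] 0 :=
      Lp.coeFn_zero F p _
    have e1 : ∫ x in Ω, fderiv ℝ φ x (EuclideanSpace.single i 1) •
        ((0 : Lp F p (volume.restrict Ω)) : Eu d → F) x = 0 := by
      rw [← integral_zero (Eu d) F (μ := volume.restrict Ω)]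
      exact integral_congr_ae (by filter_upwards [h] with x hx; rw [hx, Pi.zero_apply, smul_zero])
    have e2 : ∫ x in Ω, φ x • ((0 : Lp F p (volume.restrict Ω)) : Eu d → F) x = 0 := by
      rw [← integral_zero (Eu d) F (μ := volume.restrict Ω)]
      exact integral_congr_ae (by filter_upwards [h] with x hx; rw [hx, Pi.zero_apply, smul_zero])
    exact e1.trans (by rw [← neg_zero]; exact congrArg Neg.neg e2.symm)
  add_mem' := by
    intro U V hU hV i φ h1 h2 h3
    have hd : Continuous fun x => fderiv ℝ φ x (EuclideanSpace.single i 1) :=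
      (h1.continuous_fderiv (by simp)).clm_apply continuous_const
    have hdc : HasCompactSupport fun x => fderiv ℝ φ x (EuclideanSpace.single i 1) :=
      h2.fderiv_apply (𝕜 := ℝ) _
    have eU := hU i φ h1 h2 h3
    have eV := hV i φ h1 h2 h3
    have a1 : ∫ x in Ω, fderiv ℝ φ x (EuclideanSpace.single i 1) • (U + V).1 x =
        (∫ x in Ω, fderiv ℝ φ x (EuclideanSpace.single i 1) • U.1 x) +
          ∫ x in Ω, fderiv ℝ φ x (EuclideanSpace.single i 1) • V.1 x := by
      rw [← integral_add (integrable_test_smul hd hdc (Lp.memLp U.1))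
        (integrable_test_smul hd hdc (Lp.memLp V.1))]
      refine integral_congr_ae ?_
      filter_upwards [Lp.coeFn_add U.1 V.1] with x hx
      rw [Prod.fst_add, hx, Pi.add_apply, smul_add]
    have a2 : ∫ x in Ω, φ x • (U + V).2 i x =
        (∫ x in Ω, φ x • U.2 i x) + ∫ x in Ω, φ x • V.2 i x := by
      rw [← integral_add (integrable_test_smul h1.continuous h2 (Lp.memLp (U.2 i)))
        (integrable_test_smul h1.continuous h2 (Lp.memLp (V.2 i)))]
      refine integral_congr_ae ?_
      filter_upwards [Lp.coeFn_add (U.2 i) (V.2 i)] with x hx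
      rw [Prod.snd_add, Pi.add_apply, hx, Pi.add_apply, smul_add]
    rw [a1, a2, eU, eV, neg_add]
  smul_mem' := by
    intro c U hU i φ h1 h2 h3
    have eU := hU i φ h1 h2 h3
    have a1 : ∫ x in Ω, fderiv ℝ φ x (EuclideanSpace.single i 1) • (c • U).1 x =
        c • ∫ x in Ω, fderiv ℝ φ x (EuclideanSpace.single i 1) • U.1 x := by
      rw [← integral_smul]
      refine integral_congr_ae ?_
      filter_upwards [Lp.coeFn_smul c U.1] with x hx
      rw [Prod.smul_fst, hx, Pi.smul_apply, smul_comm]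
    have a2 : ∫ x in Ω, φ x • (c • U).2 i x = c • ∫ x in Ω, φ x • U.2 i x := by
      rw [← integral_smul]
      refine integral_congr_ae ?_
      filter_upwards [Lp.coeFn_smul c (U.2 i)] with x hx
      rw [Prod.smul_snd, Pi.smul_apply, hx, Pi.smul_apply, smul_comm]
    rw [a1, a2, eU, smul_neg]

variable {Ω : Set (Eu d)} {p : ℝ≥0∞} [Fact (1 ≤ p)]

/-- The function underlying an element of `W^{1,p}(Ω, F)`. -/
def toFun (U : W1p Ω p F) : Eu d → F := (U.1.1 : Eu d → F)

/-- The weak partial derivative `∂U/∂xᵢ` of an element of `W^{1,p}(Ω, F)`. -/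
def partialDeriv (U : W1p Ω p F) (i : Fin d) : Eu d → F := (U.1.2 i : Eu d → F)

end Sobolev

section Convergence

variable {d : ℕ} {F : Type*} [NormedAddCommGroup F] [InnerProductSpace ℝ F]
  {Ω : Set (Eu d)} {p : ℝ≥0∞} [Fact (1 ≤ p)]

/-- Weak convergence in the normed space `W^{1,p}(Ω, F)`. -/
def WeaklyConverges (U : ℕ → W1p Ω p F) (V : W1p Ω p F) : Prop :=
  ∀ L : W1p Ω p F →L[ℝ] ℝ, Tendsto (fun k => L (U k)) atTop (𝓝 (L V))

/-- Weak* convergence in `W^{1,∞}(Ω, F)`: the functions and all their weak partial derivatives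
converge weakly* in `L^∞ = (L^1)*`. -/
def WeakStarConverges (U : ℕ → W1p Ω p F) (V : W1p Ω p F) : Prop :=
  ∀ h : Eu d → F, Integrable h (volume.restrict Ω) →
    Tendsto (fun k => ∫ x in Ω, inner ℝ (h x) (toFun (U k) x)) atTop
      (𝓝 (∫ x in Ω, inner ℝ (h x) (toFun V x))) ∧
    ∀ i : Fin d, Tendsto (fun k => ∫ x in Ω, inner ℝ (h x) (partialDeriv (U k) i x)) atTop
      (𝓝 (∫ x in Ω, inner ℝ (h x) (partialDeriv V i x)))

end Convergence

section Orientable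

variable {d : ℕ} {Ω : Set (Eu d)} {p : ℝ≥0∞} [Fact (1 ≤ p)]

/-- `Q ∈ W^{1,p}(Ω, 𝒬)`: the matrix field takes values in the set of line-field matrices. -/
def IsLineField (s : ℝ) (Q : W1p Ω p Mat9) : Prop :=
  ∀ᵐ x ∂(volume.restrict Ω), asMatrix (toFun Q x) ∈ lineSet s

/-- `n ∈ W^{1,p}(Ω, 𝕊²)`. -/
def IsSphereValued (n : W1p Ω p (Eu 3)) : Prop :=
  ∀ᵐ x ∂(volume.restrict Ω), toFun n x ∈ sphere2

/-- A line field `Q ∈ W^{1,p}(Ω, 𝒬)` is orientable if `Q = P(n)` almost everywhere for some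
`n ∈ W^{1,p}(Ω, 𝕊²)`. -/
def IsOrientable (s : ℝ) (Q : W1p Ω p Mat9) : Prop :=
  IsLineField s Q ∧ ∃ n : W1p Ω p (Eu 3), IsSphereValued n ∧
    ∀ᵐ x ∂(volume.restrict Ω), projP s (toFun n x) = asMatrix (toFun Q x)

end Orientable

end LineField

end

/-! Let `Qk = P(n_k)` with unit directors `n_k`. Differentiating `Q_ab = s (n_a n_b - δ_ab / 3)` and
contracting with `n_b` gives `∂ᵢ n = s⁻¹ (∂ᵢ Q) n`, because `|n|² = 1` forces `n · ∂ᵢ n = 0`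
(`partialDeriv_director`). So `L¹` bounds on `∂ᵢ Qk` pass to `∂ᵢ n_k`, and bounded maps with
`L¹`-bounded gradients are precompact for a.e. convergence: a subsequence of `n_k` tends a.e. to
some `n'` (`exists_director_limit`). The constraints `|n'| = 1` and `P(n') = Q` survive a.e. limits.

It remains to see that `n'` is Sobolev. Weak compactness of `∂ᵢ n_k` is not available directly when
`p = 1`. Instead the limit is taken in the weak form of `∂ᵢ n_k = s⁻¹ (∂ᵢ Qk) n_k`: a bounded a.e.
convergent factor times a weakly `L¹` convergent one converges to the product of the limits
(`WeakL1.tendsto_integral_mul`). Hence `∂ᵢ n' = s⁻¹ (∂ᵢ Q) n'`, which lies in `L^p` since `n'` is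
bounded.

Since `Ω` has finite measure, weak convergence for `p < ∞` and weak* convergence for `p = ∞` both
imply weak `L¹` convergence of every component (`weakL1_component`), so the limiting arguments need
no case distinction on `p`. The product lemma rests on equi-integrability of weakly convergent `L¹`
sequences, obtained from the Baire category theorem; compactness rests on a translation estimate
tested against functions that are merely bounded. -/

noncomputable section

namespace LineField

/-! ### Weak convergence in `L¹` and equi-integrability -/

section WeakL1

variable {α : Type*} {m : MeasurableSpace α} {μ : Measure α}

/-- `h` is measurable and bounded by `1` almost everywhere. -/
def UnitBounded (μ : Measure α) (h : α → ℝ) : Prop :=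
  AEStronglyMeasurable h μ ∧ ∀ᵐ x ∂μ, |h x| ≤ 1

/-- `g k ⇀ g` weakly in `L¹(μ)`: convergence tested against bounded measurable functions. -/
def WeakL1 (μ : Measure α) (g : ℕ → α → ℝ) (g' : α → ℝ) : Prop :=
  ∀ h, UnitBounded μ h → Tendsto (fun k => ∫ x, h x * g k x ∂μ) atTop (𝓝 (∫ x, h x * g' x ∂μ))

theorem UnitBounded.integrable_mul {h g : α → ℝ} (hh : UnitBounded μ h) (hg : Integrable g μ) :
    Integrable (fun x => h x * g x) μ :=
  hg.bdd_mul hh.1 (c := 1) (by simpa only [Real.norm_eq_abs] using hh.2)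

theorem UnitBounded.integrable [IsFiniteMeasure μ] {h : α → ℝ} (hh : UnitBounded μ h) :
    Integrable h μ := by
  simpa using hh.integrable_mul (integrable_const (1 : ℝ))

theorem UnitBounded.mul {h g : α → ℝ} (hh : UnitBounded μ h) (hg : UnitBounded μ g) :
    UnitBounded μ (fun x => h x * g x) := by
  refine ⟨hh.1.mul hg.1, ?_⟩
  filter_upwards [hh.2, hg.2] with x h1 h2
  rw [abs_mul]
  exact mul_le_one₀ h1 (abs_nonneg _) h2

theorem WeakL1.comp {g : ℕ → α → ℝ} {g' : α → ℝ} (h : WeakL1 μ g g') {ns : ℕ → ℕ}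
    (hns : StrictMono ns) : WeakL1 μ (fun k => g (ns k)) g' :=
  fun f hf => (h f hf).comp hns.tendsto_atTop

theorem exists_subseq_ae_of_tendsto_L1 {f : ℕ → Lp ℝ 1 μ} {g : Lp ℝ 1 μ}
    (h : Tendsto f atTop (𝓝 g)) :
    ∃ ns : ℕ → ℕ, StrictMono ns ∧ ∀ᵐ x ∂μ, Tendsto (fun i => f (ns i) x) atTop (𝓝 (g x)) :=
  (tendstoInMeasure_of_tendsto_Lp h).exists_seq_tendsto_ae

theorem isClosed_unitBounded :
    IsClosed {h : Lp ℝ 1 μ | UnitBounded μ h} := by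
  refine IsSeqClosed.isClosed fun f g hf hg => ?_
  obtain ⟨ns, -, hns⟩ := exists_subseq_ae_of_tendsto_L1 hg
  refine ⟨Lp.aestronglyMeasurable g, ?_⟩
  filter_upwards [hns, ae_all_iff.2 fun i => (hf (ns i)).2] with x hx h1
  exact le_of_tendsto' hx.abs h1

/-- For a merely integrable `g` the map `h ↦ ∫ h g` need not be defined on all of `L¹`; on the
unit-bounded functions it is continuous for the `L¹` distance, by dominated convergence along an
a.e. convergent subsequence. -/
theorem isClosed_abs_integral_le {g : α → ℝ} (hg : Integrable g μ) (ε : ℝ) :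
    IsClosed {h : {h : Lp ℝ 1 μ | UnitBounded μ h} | |∫ x, (h : Lp ℝ 1 μ) x * g x ∂μ| ≤ ε} := by
  refine IsSeqClosed.isClosed fun f h hf hh => ?_
  have hh' : Tendsto (fun k => (f k : Lp ℝ 1 μ)) atTop (𝓝 (h : Lp ℝ 1 μ)) :=
    (continuous_subtype_val.tendsto _).comp hh
  obtain ⟨ns, -, hns⟩ := exists_subseq_ae_of_tendsto_L1 hh'
  have hlim : Tendsto (fun i => ∫ x, (f (ns i) : Lp ℝ 1 μ) x * g x ∂μ) atTop
      (𝓝 (∫ x, (h : Lp ℝ 1 μ) x * g x ∂μ)) := by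
    refine tendsto_integral_of_dominated_convergence (fun x => |g x|)
      (fun i => ((f (ns i)).2.integrable_mul hg).1) hg.abs (fun i => ?_) ?_
    · filter_upwards [(f (ns i)).2.2] with x hx
      rw [Real.norm_eq_abs, abs_mul]
      exact mul_le_of_le_one_left (abs_nonneg _) hx
    · filter_upwards [hns] with x hx
      exact hx.mul_const _
  exact le_of_tendsto' hlim.abs fun i => hf (ns i)

/-- Here `a` is clipped to the interval of those `c` with `|c| ≤ 1` and `|c + b| ≤ 1`. This writes
`b = (c + b) - c` as a difference of two points of `[-1, 1]`, each within `|b|` of `a`. It replaces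
the translation `a + b`, which may leave `[-1, 1]`. -/
theorem abs_clip_le {a b : ℝ} (ha : |a| ≤ 1) (hb : |b| ≤ 1) :
    |max (max (-1) (-1 - b)) (min a (min 1 (1 - b)))| ≤ 1 ∧
    |max (max (-1) (-1 - b)) (min a (min 1 (1 - b))) + b| ≤ 1 ∧
    |max (max (-1) (-1 - b)) (min a (min 1 (1 - b))) - a| ≤ |b| ∧
    |max (max (-1) (-1 - b)) (min a (min 1 (1 - b))) + b - a| ≤ |b| := by
  generalize hM : max (-1 : ℝ) (-1 - b) = M
  generalize hm : min (1 : ℝ) (1 - b) = m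
  simp only [abs_le] at *
  rcases abs_cases b with ⟨h, h'⟩ | ⟨h, h'⟩ <;> rw [h] <;>
  rcases max_cases (-1) (-1 - b) with h1 | h1 <;>
  rcases min_cases 1 (1 - b) with h2 | h2 <;>
  rcases min_cases a m with h3 | h3 <;> rw [h3.1]
  all_goals
    first
    | (rcases max_cases M a with h4 | h4 <;> rw [h4.1] <;>
        refine ⟨⟨?_, ?_⟩, ⟨?_, ?_⟩, ⟨?_, ?_⟩, ⟨?_, ?_⟩⟩ <;> linarith)
    | (rcases max_cases M m with h4 | h4 <;> rw [h4.1] <;>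
        refine ⟨⟨?_, ?_⟩, ⟨?_, ?_⟩, ⟨?_, ?_⟩, ⟨?_, ?_⟩⟩ <;> linarith)

/-- Weakly convergent sequences in `L¹` are equi-integrable. -/
theorem WeakL1.equiintegrable [IsFiniteMeasure μ] {g : ℕ → α → ℝ} {g' : α → ℝ}
    (hg : ∀ k, Integrable (g k) μ) (hg' : Integrable g' μ) (hw : WeakL1 μ g g')
    {ε : ℝ} (hε : 0 < ε) :
    ∃ r > 0, ∃ N : ℕ, ∀ k ≥ N, ∀ h, UnitBounded μ h → ∫ x, |h x| ∂μ < r →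
      |∫ x, h x * (g k x - g' x) ∂μ| ≤ ε := by
  -- The Baire space is the unit-bounded functions with the `L¹` distance, complete as a closed
  -- subset of `L¹`.
  let S : Set (Lp ℝ 1 μ) := {h | UnitBounded μ h}
  have hS : IsClosed S := isClosed_unitBounded
  have : CompleteSpace S := hS.completeSpace_coe
  have : Nonempty S := ⟨⟨0, (Lp.aestronglyMeasurable _), by
    filter_upwards [Lp.coeFn_zero ℝ 1 μ] with x hx
    rw [hx]
    simp⟩⟩
  -- Weak convergence says that the closed sets `F N` cover `S`, so one of them contains a ball,
  -- around some `h0`.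
  let F : ℕ → Set S := fun N =>
    ⋂ k ≥ N, {h : S | |∫ x, (h : Lp ℝ 1 μ) x * (g k x - g' x) ∂μ| ≤ ε / 2}
  have hF : ∀ N, IsClosed (F N) := fun N =>
    isClosed_biInter fun k _ => isClosed_abs_integral_le ((hg k).sub hg') _
  have hU : ⋃ N, F N = univ := by
    refine eq_univ_of_forall fun h => ?_
    have h1 := tendsto_iff_dist_tendsto_zero.1 (hw _ h.2)
    obtain ⟨N, hN⟩ := eventually_atTop.1 (h1.eventually (gt_mem_nhds (half_pos hε)))
    refine mem_iUnion.2 ⟨N, mem_iInter₂.2 fun k hk => ?_⟩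
    have h2 := (hN k hk).le
    rw [Real.dist_eq, ← integral_sub (h.2.integrable_mul (hg k)) (h.2.integrable_mul hg')] at h2
    simpa only [mem_ofPred_eq, mul_sub] using h2
  obtain ⟨N, h0, hh0⟩ := nonempty_interior_of_iUnion_of_closed hF hU
  obtain ⟨r, hr, hball⟩ := Metric.mem_nhds_iff.1 (mem_interior_iff_mem_nhds.1 hh0)
  have key : ∀ k ≥ N, ∀ h, UnitBounded μ h → ∫ x, |h x - (h0 : Lp ℝ 1 μ) x| ∂μ < r →
      |∫ x, h x * (g k x - g' x) ∂μ| ≤ ε / 2 := by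
    intro k hk h hh hd
    have hi := memLp_one_iff_integrable.2 hh.integrable
    have e := hi.coeFn_toLp
    have hmem : UnitBounded μ (hi.toLp h) := ⟨Lp.aestronglyMeasurable _, by
      filter_upwards [e, hh.2] with x h1 h2
      rwa [h1]⟩
    have hb : (⟨hi.toLp h, hmem⟩ : S) ∈ Metric.ball h0 r := by
      rw [Metric.mem_ball, Subtype.dist_eq, L1.dist_eq_integral_dist]
      refine lt_of_eq_of_lt (integral_congr_ae ?_) hd
      filter_upwards [e] with x h1
      rw [h1, Real.dist_eq]
    have h2 := mem_iInter₂.1 (hball hb) k hk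
    rw [mem_ofPred_eq] at h2
    convert h2 using 2
    refine integral_congr_ae ?_
    filter_upwards [e] with x h1
    rw [h1]
  refine ⟨r, hr, N, fun k hk h hh hd => ?_⟩
  set a : α → ℝ := fun x => (h0 : Lp ℝ 1 μ) x with ha
  have ham : AEStronglyMeasurable a μ := h0.2.1
  -- Moves the estimate from the ball around `h0` to one around `0`: `h` is the difference of `c +
  -- h` and `c`, both in the ball, and each contributes at most `ε / 2`.
  set c : α → ℝ := fun x => max (max (-1) (-1 - h x)) (min (a x) (min 1 (1 - h x))) with hc
  have hcm : AEStronglyMeasurable c μ := by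
    have h1 : AEMeasurable h μ := hh.1.aemeasurable
    have h2 : AEMeasurable a μ := ham.aemeasurable
    exact ((aemeasurable_const.max (aemeasurable_const.sub h1)).max
      (h2.min (aemeasurable_const.min (aemeasurable_const.sub h1)))).aestronglyMeasurable
  have hcb : UnitBounded μ c := ⟨hcm, by
    filter_upwards [h0.2.2, hh.2] with x h1 h2 using (abs_clip_le h1 h2).1⟩
  have hchb : UnitBounded μ (fun x => c x + h x) := ⟨hcm.add hh.1, by
    filter_upwards [h0.2.2, hh.2] with x h1 h2 using (abs_clip_le h1 h2).2.1⟩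
  have hai : Integrable a μ := h0.2.integrable
  have k1 := key k hk _ hcb (lt_of_le_of_lt (integral_mono_ae (hcb.integrable.sub hai).abs
    hh.integrable.abs (by
      filter_upwards [h0.2.2, hh.2] with x h1 h2 using (abs_clip_le h1 h2).2.2.1)) hd)
  have k2 := key k hk _ hchb (lt_of_le_of_lt (integral_mono_ae (hchb.integrable.sub hai).abs
    hh.integrable.abs (by
      filter_upwards [h0.2.2, hh.2] with x h1 h2 using (abs_clip_le h1 h2).2.2.2)) hd)
  have hdi : Integrable (fun x => g k x - g' x) μ := (hg k).sub hg'
  have e : ∫ x, h x * (g k x - g' x) ∂μ =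
      ∫ x, (c x + h x) * (g k x - g' x) ∂μ - ∫ x, c x * (g k x - g' x) ∂μ := by
    rw [← integral_sub (hchb.integrable_mul hdi) (hcb.integrable_mul hdi)]
    congr 1
    ext x
    ring
  rw [e]
  calc _ ≤ _ := abs_sub _ _
    _ ≤ ε := by linarith

/-- Testing against a small multiple `t` of the sign of `g k - g'` and using equi-integrability with
`ε = 1` yields `t ∫ |g k - g'| ≤ 1` for large `k`. -/
theorem WeakL1.eventually_integral_abs_le [IsFiniteMeasure μ] {g : ℕ → α → ℝ} {g' : α → ℝ}
    (hg : ∀ k, Integrable (g k) μ) (hg' : Integrable g' μ) (hw : WeakL1 μ g g') :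
    ∃ C : ℝ, ∀ᶠ k in atTop, ∫ x, |g k x| ∂μ ≤ C := by
  obtain ⟨r, hr, N, hN⟩ := hw.equiintegrable hg hg' one_pos
  set M := μ.real univ with hM
  have hM0 : 0 ≤ M := measureReal_nonneg
  -- The minimum with `1` keeps the test function unit-bounded; the other term makes its `L¹` norm,
  -- at most `M * t`, less than `r`, with `M + 1` covering `M = 0`.
  set t : ℝ := min 1 (r / (2 * (M + 1))) with ht
  have ht0 : 0 < t := lt_min one_pos (by positivity)
  refine ⟨1 / t + ∫ x, |g' x| ∂μ, eventually_atTop.2 ⟨N, fun k hk => ?_⟩⟩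
  set f : α → ℝ := fun x => g k x - g' x with hf
  have hfi : Integrable f μ := (hg k).sub hg'
  have hsgn : ∀ y : ℝ, |SignType.cast (SignType.sign y)| ≤ (1 : ℝ) := fun y => by
    rcases lt_trichotomy y 0 with h | h | h <;> simp [h]
  have hsm : AEStronglyMeasurable (fun x => t * ((SignType.sign (f x) : SignType) : ℝ)) μ := by
    have h1 : Measurable fun y : ℝ => ((SignType.sign y : SignType) : ℝ) := by
      have : (fun y : ℝ => ((SignType.sign y : SignType) : ℝ)) =
          fun y => if 0 < y then 1 else if y < 0 then -1 else 0 := by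
        ext y
        rcases lt_trichotomy y 0 with h | h | h <;> simp [h, h.le, not_lt.2]
      rw [this]
      exact Measurable.ite measurableSet_Ioi measurable_const
        (Measurable.ite measurableSet_Iio measurable_const measurable_const)
    exact ((h1.comp_aemeasurable hfi.1.aemeasurable).const_mul t).aestronglyMeasurable
  have hb : ∀ x, |t * ((SignType.sign (f x) : SignType) : ℝ)| ≤ t := fun x => by
    rw [abs_mul, abs_of_pos ht0]
    exact mul_le_of_le_one_right ht0.le (hsgn _)
  have hub : UnitBounded μ (fun x => t * ((SignType.sign (f x) : SignType) : ℝ)) :=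
    ⟨hsm, ae_of_all _ fun x => (hb x).trans (min_le_left _ _)⟩
  have hlt : ∫ x, |t * ((SignType.sign (f x) : SignType) : ℝ)| ∂μ < r := by
    calc _ ≤ ∫ _, t ∂μ := integral_mono hub.integrable.abs (integrable_const _) hb
      _ = M * t := by simp [hM]
      _ ≤ M * (r / (2 * (M + 1))) := by gcongr; exact min_le_right _ _
      _ < r := by
        rw [← mul_div_assoc, div_lt_iff₀ (by positivity)]
        nlinarith
  have h1 := hN k hk _ hub hlt
  have e : ∫ x, t * ((SignType.sign (f x) : SignType) : ℝ) * (g k x - g' x) ∂μ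
      = t * ∫ x, |f x| ∂μ := by
    rw [← integral_const_mul]
    congr 1
    ext x
    rw [mul_assoc, sign_mul_self]
  rw [e, abs_of_nonneg (mul_nonneg ht0.le (integral_nonneg fun x => abs_nonneg _))] at h1
  have h2 : ∫ x, |f x| ∂μ ≤ 1 / t := by
    rw [le_div_iff₀ ht0]
    linarith
  have h3 : ∫ x, |g k x| ∂μ ≤ ∫ x, (|f x| + |g' x|) ∂μ := by
    refine integral_mono (hg k).abs (hfi.abs.add hg'.abs) fun x => ?_
    calc |g k x| = |f x + g' x| := by simp [hf]
      _ ≤ _ := abs_add_le _ _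
  rw [integral_add hfi.abs hg'.abs] at h3
  linarith

/-- The product of a bounded, almost everywhere convergent sequence and a weakly convergent one. -/
theorem WeakL1.tendsto_integral_mul [IsFiniteMeasure μ] {g : ℕ → α → ℝ} {g' : α → ℝ}
    (hg : ∀ k, Integrable (g k) μ) (hg' : Integrable g' μ) (hw : WeakL1 μ g g')
    {h : ℕ → α → ℝ} {h' : α → ℝ} (hh : ∀ k, UnitBounded μ (h k)) (hh' : UnitBounded μ h')
    (hlim : ∀ᵐ x ∂μ, Tendsto (fun k => h k x) atTop (𝓝 (h' x))) :
    Tendsto (fun k => ∫ x, h k x * g k x ∂μ) atTop (𝓝 (∫ x, h' x * g' x ∂μ)) := by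
  -- Halving keeps the difference unit-bounded. The product then splits as `h k * g k = 2 * (w k *
  -- (g k - g') + w k * g') + h' * g k`: equi-integrability, dominated convergence and weak
  -- convergence handle the three terms.
  set w : ℕ → α → ℝ := fun k x => (h k x - h' x) / 2 with hwdef
  have hwb : ∀ k, UnitBounded μ (w k) := fun k => by
    refine ⟨((hh k).1.sub hh'.1).mul_const (1 / 2) |>.congr
      (ae_of_all _ fun x => by simp [hwdef]; ring), ?_⟩
    filter_upwards [(hh k).2, hh'.2] with x h1 h2
    rw [hwdef, abs_div, abs_two]
    have := abs_sub (h k x) (h' x)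
    linarith
  have hw0 : ∀ᵐ x ∂μ, Tendsto (fun k => w k x) atTop (𝓝 0) := by
    filter_upwards [hlim] with x hx
    have := (hx.sub_const (h' x)).div_const 2
    simpa using this
  have hwi : Tendsto (fun k => ∫ x, |w k x| ∂μ) atTop (𝓝 0) := by
    have := tendsto_integral_of_dominated_convergence (μ := μ) (F := fun k x => |w k x|)
      (f := fun _ => 0) (fun _ => 1)
      (fun k => (hwb k).integrable.abs.1) (integrable_const _)
      (fun k => by
        filter_upwards [(hwb k).2] with x hx
        simpa using hx)
      (by
        filter_upwards [hw0] with x hx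
        simpa using hx.abs)
    simpa using this
  have hd : Tendsto (fun k => ∫ x, w k x * (g k x - g' x) ∂μ) atTop (𝓝 0) := by
    refine Metric.tendsto_atTop.2 fun ε hε => ?_
    obtain ⟨r, hr, N, hN⟩ := hw.equiintegrable hg hg' (half_pos hε)
    obtain ⟨N', hN'⟩ := eventually_atTop.1 (hwi.eventually (gt_mem_nhds hr))
    refine ⟨max N N', fun k hk => ?_⟩
    have := hN k (le_of_max_le_left hk) _ (hwb k) (hN' k (le_of_max_le_right hk))
    rw [Real.dist_eq, sub_zero]
    linarith
  have hd' : Tendsto (fun k => ∫ x, w k x * g' x ∂μ) atTop (𝓝 0) := by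
    have := tendsto_integral_of_dominated_convergence (μ := μ) (F := fun k x => w k x * g' x)
      (f := fun _ => 0) (fun x => |g' x|)
      (fun k => ((hwb k).integrable_mul hg').1) hg'.abs
      (fun k => by
        filter_upwards [(hwb k).2] with x hx
        rw [Real.norm_eq_abs, abs_mul]
        exact mul_le_of_le_one_left (abs_nonneg _) hx)
      (by
        filter_upwards [hw0] with x hx
        simpa using hx.mul_const (g' x))
    simpa using this
  have hsum := ((hd.add hd').const_mul 2).add (hw h' hh')
  simp only [add_zero, mul_zero, zero_add] at hsum
  refine hsum.congr fun k => ?_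
  have i1 : Integrable (fun x => w k x * (g k x - g' x)) μ :=
    (hwb k).integrable_mul ((hg k).sub hg')
  have i2 := (hwb k).integrable_mul hg'
  have i3 : Integrable (fun x => 2 * (w k x * (g k x - g' x) + w k x * g' x)) μ :=
    (i1.add i2).const_mul 2
  rw [← integral_add i1 i2, ← integral_const_mul, ← integral_add i3 (hh'.integrable_mul (hg k))]
  refine integral_congr_ae (ae_of_all _ fun x => ?_)
  simp only [hwdef]
  ring

end WeakL1

/-! ### Mollification on `ℝᵈ` -/

section Mollifier

variable {d : ℕ}

/-- A smooth bump supported in the ball of radius `1 / (j + 1)`. -/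
def bump (d j : ℕ) : ContDiffBump (0 : Eu d) where
  rIn := 1 / (2 * (j + 1))
  rOut := 1 / (j + 1)
  rIn_pos := by positivity
  rIn_lt_rOut := by
    rw [one_div, one_div, mul_inv]
    have : (0 : ℝ) < ((j : ℝ) + 1)⁻¹ := by positivity
    linarith

/-- The standard mollifiers. -/
def mollifier (d j : ℕ) : Eu d → ℝ := (bump d j).normed volume

theorem contDiff_mollifier (j : ℕ) : ContDiff ℝ ∞ (mollifier d j) := (bump d j).contDiff_normed

theorem continuous_mollifier (j : ℕ) : Continuous (mollifier d j) :=
  (contDiff_mollifier j).continuous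

theorem hasCompactSupport_mollifier (j : ℕ) : HasCompactSupport (mollifier d j) :=
  (bump d j).hasCompactSupport_normed

theorem integrable_mollifier (j : ℕ) : Integrable (mollifier d j) :=
  (continuous_mollifier j).integrable_of_hasCompactSupport (hasCompactSupport_mollifier j)

theorem mollifier_nonneg (j : ℕ) (x : Eu d) : 0 ≤ mollifier d j x := (bump d j).nonneg_normed x

theorem mollifier_neg (j : ℕ) (x : Eu d) : mollifier d j (-x) = mollifier d j x :=
  (bump d j).normed_neg x

theorem mollifier_sub_comm (j : ℕ) (x y : Eu d) :
    mollifier d j (x - y) = mollifier d j (y - x) := by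
  rw [← mollifier_neg, neg_sub]

theorem integral_mollifier (j : ℕ) : ∫ x, mollifier d j x = 1 := (bump d j).integral_normed

theorem integral_mollifier_sub (j : ℕ) (x : Eu d) : ∫ y, mollifier d j (x - y) = 1 := by
  rw [integral_sub_left_eq_self (mollifier d j) volume x, integral_mollifier]

theorem tsupport_mollifier (j : ℕ) :
    tsupport (mollifier d j) = Metric.closedBall 0 (1 / ((j : ℝ) + 1)) :=
  (bump d j).tsupport_normed_eq

theorem mollifier_eq_zero {j : ℕ} {x : Eu d} (h : 1 / ((j : ℝ) + 1) < ‖x‖) :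
    mollifier d j x = 0 := by
  refine image_eq_zero_of_notMem_tsupport ?_
  rw [tsupport_mollifier]
  simpa using h

/-- Mollification of a function. -/
def mollify (j : ℕ) (f : Eu d → ℝ) (x : Eu d) : ℝ := ∫ y, f y * mollifier d j (x - y)

theorem mollify_eq_convolution (j : ℕ) (f : Eu d → ℝ) :
    mollify j f = convolution f (mollifier d j) (ContinuousLinearMap.lsmul ℝ ℝ) volume := rfl

theorem mollify_eq_swap (j : ℕ) (f : Eu d → ℝ) (x : Eu d) :
    mollify j f x = ∫ h, mollifier d j h * f (x - h) := by
  rw [mollify_eq_convolution, convolution_eq_swap]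
  simp [mul_comm]

theorem contDiff_mollify (j : ℕ) {f : Eu d → ℝ} (hf : Integrable f) : ContDiff ℝ ∞ (mollify j f) :=
  (hasCompactSupport_mollifier j).contDiff_convolution_right (ContinuousLinearMap.lsmul ℝ ℝ)
    hf.locallyIntegrable (contDiff_mollifier j)

theorem ae_tendsto_mollify {f : Eu d → ℝ} (hf : Integrable f) :
    ∀ᵐ x, Tendsto (fun j => mollify j f x) atTop (𝓝 (f x)) := by
  -- `K := 2` is the ratio of the outer to the inner radius of `bump`.
  have h := ContDiffBump.ae_convolution_tendsto_right_of_locallyIntegrable (μ := volume)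
    (φ := fun j => bump d j) (l := atTop) (K := 2)
    (tendsto_one_div_add_atTop_nhds_zero_nat (𝕜 := ℝ))
    (Eventually.of_forall fun j => by
      change 1 / ((j : ℝ) + 1) ≤ 2 * (1 / (2 * (j + 1)))
      refine le_of_eq ?_
      field_simp) hf.locallyIntegrable
  filter_upwards [h] with x hx
  refine hx.congr fun j => ?_
  rw [convolution_eq_swap, mollify]
  simp [mul_comm, mollifier]

theorem abs_mollify_le {f : Eu d → ℝ} {M : ℝ} (hf : ∀ᵐ x, |f x| ≤ M) (j : ℕ) (x : Eu d) :
    |mollify j f x| ≤ M := by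
  have hi : Integrable fun y => mollifier d j (x - y) := (integrable_mollifier j).comp_sub_left x
  have h := norm_integral_le_of_norm_le (f := fun y => f y * mollifier d j (x - y))
    (hi.const_mul M) (by
      filter_upwards [hf] with y hy
      rw [norm_mul, Real.norm_eq_abs, Real.norm_of_nonneg (mollifier_nonneg _ _)]
      exact mul_le_mul_of_nonneg_right hy (mollifier_nonneg _ _))
  rwa [integral_const_mul, integral_mollifier_sub, mul_one] at h

theorem tsupport_mollify_subset {f : Eu d → ℝ} {K : Set (Eu d)} (hf : ∀ x ∉ K, f x = 0)
    (j : ℕ) : tsupport (mollify j f) ⊆ Metric.cthickening (1 / ((j : ℝ) + 1)) K := by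
  refine closure_minimal (fun x hx => ?_) Metric.isClosed_cthickening
  by_contra hxK
  refine hx (integral_eq_zero_of_ae (ae_of_all _ fun y => ?_))
  by_cases hy : y ∈ K
  · have : 1 / ((j : ℝ) + 1) < ‖x - y‖ := by
      by_contra hle
      exact hxK (Metric.mem_cthickening_of_dist_le x y _ K hy (by rw [dist_eq_norm]; linarith))
    simp [mollifier_eq_zero this]
  · simp [hf y hy]

/-- Mollification is self-adjoint: the kernel is even and Fubini applies. -/
theorem integral_mul_mollify_comm {A B : Eu d → ℝ} (hA : Integrable A) (hB : Integrable B) (j : ℕ) :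
    ∫ x, A x * mollify j B x = ∫ y, B y * mollify j A y := by
  obtain ⟨C, hC⟩ := (hasCompactSupport_mollifier (d := d) j).exists_bound_of_continuous
    (continuous_mollifier j)
  have hi : Integrable (fun p : Eu d × Eu d => A p.1 * B p.2 * mollifier d j (p.1 - p.2))
      (volume.prod volume) :=
    (hA.mul_prod hB).mul_bdd (c := C)
      ((continuous_mollifier j).comp (continuous_fst.sub continuous_snd)).aestronglyMeasurable
      (ae_of_all _ fun p => hC _)
  calc ∫ x, A x * mollify j B x
      = ∫ x, ∫ y, A x * B y * mollifier d j (x - y) := by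
        refine integral_congr_ae (ae_of_all _ fun x => ?_)
        simp only [mollify, ← integral_const_mul, mul_assoc]
    _ = ∫ y, ∫ x, A x * B y * mollifier d j (x - y) := integral_integral_swap hi
    _ = _ := by
        refine integral_congr_ae (ae_of_all _ fun y => ?_)
        simp only [mollify, ← integral_const_mul]
        refine integral_congr_ae (ae_of_all _ fun x => ?_)
        simp only [mollifier_sub_comm j x y]
        ring

end Mollifier

/-! ### Translation and mollification estimates from an integrable weak gradient -/

section WeakPartial

variable {d : ℕ} {Ω : Set (Eu d)}

theorem hasFDerivAt_setIntegral_mul_sub (hΩ : MeasurableSet Ω) {u η : Eu d → ℝ}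
    (hu : IntegrableOn u Ω) (hη : ContDiff ℝ ∞ η) (hc : HasCompactSupport η) (x : Eu d) :
    HasFDerivAt (fun x => ∫ y in Ω, u y * η (x - y))
      (∫ y in Ω, u y • fderiv ℝ η (x - y)) x := by
  have h := hc.hasFDerivAt_convolution_right (ContinuousLinearMap.lsmul ℝ ℝ)
    (hu.integrable_indicator hΩ).locallyIntegrable (hη.of_le (by simp)) x
  have e1 : (fun x => ∫ y in Ω, u y * η (x - y)) =
      convolution (Ω.indicator u) η (ContinuousLinearMap.lsmul ℝ ℝ) volume := by
    funext z
    rw [convolution_def, ← integral_indicator hΩ]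
    refine integral_congr_ae (ae_of_all _ fun y => ?_)
    by_cases hy : y ∈ Ω <;> simp [hy]
  have e2 : ∫ y in Ω, u y • fderiv ℝ η (x - y) = convolution (Ω.indicator u) (fderiv ℝ η)
      ((ContinuousLinearMap.lsmul ℝ ℝ).precompR (Eu d)) volume x := by
    rw [convolution_def, ← integral_indicator hΩ]
    refine integral_congr_ae (ae_of_all _ fun y => ?_)
    by_cases hy : y ∈ Ω
    · ext v
      simp [hy, ContinuousLinearMap.precompR]
    · simp [hy]
  rw [e1, e2]
  exact h

/-- The reflected translate `y ↦ η (x - y)` is an admissible test function, and the sign produced by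
the reflection cancels the one from integration by parts. -/
theorem IsWeakPartial.setIntegral_smul_fderiv_sub {i : Fin d} {u g : Eu d → ℝ}
    (h : IsWeakPartial Ω i u g) (hu : IntegrableOn u Ω) {η : Eu d → ℝ} (hη : ContDiff ℝ ∞ η)
    (hc : HasCompactSupport η) (x : Eu d) (hx : ∀ y, x - y ∈ tsupport η → y ∈ Ω) :
    (∫ y in Ω, u y • fderiv ℝ η (x - y)) (EuclideanSpace.single i 1) =
      ∫ y in Ω, g y * η (x - y) := by
  have hcont : Continuous fun y : Eu d => x - y := continuous_const.sub continuous_id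
  have h1 : ContDiff ℝ ∞ fun y => η (x - y) := hη.comp (contDiff_const.sub contDiff_id)
  have h2 : HasCompactSupport fun y => η (x - y) :=
    hc.comp_homeomorph (Homeomorph.subLeft x)
  have h3 : tsupport (fun y => η (x - y)) ⊆ Ω := fun y hy =>
    hx y (tsupport_comp_subset_preimage η hcont hy)
  have h4 := h _ h1 h2 h3
  have hd : ∀ y, fderiv ℝ (fun y => η (x - y)) y = -fderiv ℝ η (x - y) := fun y => by
    have := ((hη.differentiable (by simp)) (x - y)).hasFDerivAt.comp y
      ((hasFDerivAt_const x y).sub (hasFDerivAt_id y))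
    rw [HasFDerivAt.fderiv (f := fun y => η (x - y)) this]
    ext v
    simp
  obtain ⟨C, hC⟩ := (hc.fderiv ℝ).exists_bound_of_continuous (hη.continuous_fderiv (by simp))
  have hi : Integrable (fun y => u y • fderiv ℝ η (x - y)) (volume.restrict Ω) :=
    Integrable.smul_bdd hu C
      ((hη.continuous_fderiv (by simp)).comp hcont).aestronglyMeasurable
      (ae_of_all _ fun y => hC _)
  rw [ContinuousLinearMap.integral_apply hi]
  simp only [hd, smul_eq_mul, neg_apply, neg_mul, integral_neg, neg_inj] at h4
  simp only [smul_apply, smul_eq_mul]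
  rw [← integral_congr_ae (ae_of_all _ fun y => mul_comm _ _), h4]
  exact integral_congr_ae (ae_of_all _ fun y => mul_comm _ _)

theorem abs_clm_le_of_abs_single_le (D : Eu d →L[ℝ] ℝ) {c : Fin d → ℝ}
    (h : ∀ i, |D (EuclideanSpace.single i 1)| ≤ c i) : ‖D‖ ≤ ∑ i, c i := by
  refine D.opNorm_le_bound (Finset.sum_nonneg fun i _ => (abs_nonneg _).trans (h i)) fun v => ?_
  have hv : v = ∑ i, v i • (EuclideanSpace.single i (1 : ℝ) : Eu d) := by
    ext j
    simp [Pi.single_apply]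
  rw [hv, map_sum, ← hv, Finset.sum_mul]
  refine (norm_sum_le _ _).trans (Finset.sum_le_sum fun i _ => ?_)
  rw [map_smul, norm_smul, mul_comm]
  exact mul_le_mul (h i) (PiLp.norm_apply_le v i) (norm_nonneg _) ((abs_nonneg _).trans (h i))

/-- With `η z = φ (-z)`, the integral of `u y * φ (y - h)` is a convolution evaluated at `h`. Its
derivative can be moved onto `u` for shifts up to `r`, so it is bounded by `M` times the `L¹` norms
of the `g i`, and the mean value inequality applies. No derivative of `φ` enters the bound, which
lets smoothness of `φ` be dropped afterwards. -/
theorem abs_setIntegral_mul_sub_le_of_contDiff (hΩ : MeasurableSet Ω) {u : Eu d → ℝ}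
    {g : Fin d → Eu d → ℝ} (hu : IntegrableOn u Ω) (hg : ∀ i, IntegrableOn (g i) Ω)
    (hw : ∀ i, IsWeakPartial Ω i u (g i)) {φ : Eu d → ℝ} (hφ : ContDiff ℝ ∞ φ)
    (hc : HasCompactSupport φ) {M r : ℝ} (hM : ∀ x, |φ x| ≤ M)
    (hr : ∀ z : Eu d, ‖z‖ ≤ r → ∀ y, y - z ∈ tsupport φ → y ∈ Ω) {h : Eu d} (hh : ‖h‖ ≤ r) :
    |∫ y in Ω, u y * (φ (y - h) - φ y)| ≤ M * (∑ i, ∫ y in Ω, |g i y|) * ‖h‖ := by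
  set η : Eu d → ℝ := fun z => φ (-z) with hηdef
  have hη : ContDiff ℝ ∞ η := hφ.comp contDiff_neg
  have hηc : HasCompactSupport η := hc.comp_homeomorph (Homeomorph.neg _)
  have hηM : ∀ x, |η x| ≤ M := fun x => hM _
  have hηs : ∀ z, z ∈ tsupport η → -z ∈ tsupport φ := fun z hz =>
    tsupport_comp_subset_preimage φ continuous_neg hz
  have hr0 : 0 ≤ r := (norm_nonneg h).trans hh
  have hD := Convex.norm_image_sub_le_of_norm_hasFDerivWithin_le (𝕜 := ℝ)
    (f := fun x => ∫ y in Ω, u y * η (x - y)) (C := M * ∑ i, ∫ y in Ω, |g i y|)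
    (f' := fun x => ∫ y in Ω, u y • fderiv ℝ η (x - y))
    (s := Metric.closedBall (0 : Eu d) r) (x := 0) (y := h)
    (fun x _ => (hasFDerivAt_setIntegral_mul_sub hΩ hu hη hηc x).hasFDerivWithinAt)
    (fun x hx => by
      rw [Finset.mul_sum]
      refine abs_clm_le_of_abs_single_le _ fun i => ?_
      rw [(hw i).setIntegral_smul_fderiv_sub hu hη hηc x fun y hy =>
        hr x (by simpa using hx) y (by simpa using hηs _ hy), ← integral_const_mul,
        ← Real.norm_eq_abs]
      refine norm_integral_le_of_norm_le ((hg i).abs.const_mul M) (ae_of_all _ fun y => ?_)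
      rw [norm_mul, mul_comm]
      exact mul_le_mul_of_nonneg_right (hηM _) (norm_nonneg _))
    (convex_closedBall _ _) (by simpa using hr0) (by simpa using hh)
  rw [sub_zero] at hD
  have hint : ∀ z, Integrable (fun y => u y * η (z - y)) (volume.restrict Ω) := fun z =>
    Integrable.mul_bdd (c := M) hu
      (hη.continuous.comp (continuous_sub_left z)).aestronglyMeasurable
      (ae_of_all _ fun y => hηM _)
  rw [← integral_sub (hint h) (hint 0), Real.norm_eq_abs] at hD
  convert hD using 3
  ext y
  simp [hηdef]
  ring

/-- Translation estimate, in dual form, for functions with integrable weak gradient. -/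
theorem abs_setIntegral_mul_sub_le (hΩ : MeasurableSet Ω) {u : Eu d → ℝ}
    {g : Fin d → Eu d → ℝ} (hu : IntegrableOn u Ω) (hg : ∀ i, IntegrableOn (g i) Ω)
    (hw : ∀ i, IsWeakPartial Ω i u (g i)) {φ : Eu d → ℝ} (hφ : Measurable φ)
    {M r : ℝ} (hM : ∀ x, |φ x| ≤ M) {K : Set (Eu d)} (hK : IsCompact K) (hφK : ∀ x ∉ K, φ x = 0)
    (hr : 0 < r) (hKΩ : Metric.cthickening (r + r) K ⊆ Ω) {h : Eu d} (hh : ‖h‖ ≤ r) :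
    |∫ y in Ω, u y * (φ (y - h) - φ y)| ≤ M * (∑ i, ∫ y in Ω, |g i y|) * ‖h‖ := by
  have hM0 : 0 ≤ M := (abs_nonneg _).trans (hM 0)
  have hφi : Integrable φ := by
    have h1 : IntegrableOn φ K := Measure.integrableOn_of_bounded hK.measure_lt_top.ne
      hφ.aestronglyMeasurable (ae_of_all _ fun x => hM x)
    rwa [integrableOn_iff_integrable_of_support_subset (fun x hx => by
      by_contra hxK
      exact hx (hφK x hxK))] at h1
  have hae := ae_tendsto_mollify hφi
  have hae' : ∀ᵐ x, Tendsto (fun j => mollify j φ (x - h)) atTop (𝓝 (φ (x - h))) :=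
    (measurePreserving_sub_right volume h).quasiMeasurePreserving.ae hae
  have hb : ∀ j x, |mollify j φ x| ≤ M := fun j x => abs_mollify_le (ae_of_all _ hM) j x
  have hmc : ∀ j, Continuous (mollify j φ) := fun j => (contDiff_mollify j hφi).continuous
  have hlim : Tendsto (fun j => ∫ y in Ω, u y * (mollify j φ (y - h) - mollify j φ y)) atTop
      (𝓝 (∫ y in Ω, u y * (φ (y - h) - φ y))) := by
    refine tendsto_integral_of_dominated_convergence (fun y => |u y| * (M + M)) (fun j => ?_)
      (hu.abs.mul_const _) (fun j => ae_of_all _ fun y => ?_) ?_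
    · exact hu.1.mul (((hmc j).comp (continuous_id.sub continuous_const)).sub
        (hmc j)).aestronglyMeasurable
    · rw [norm_mul, Real.norm_eq_abs, Real.norm_eq_abs]
      exact mul_le_mul_of_nonneg_left ((abs_sub _ _).trans (add_le_add (hb _ _) (hb _ _)))
        (abs_nonneg _)
    · filter_upwards [ae_restrict_of_ae hae, ae_restrict_of_ae hae'] with y h1 h2
      exact (h2.sub h1).const_mul _
  refine le_of_tendsto hlim.abs ?_
  filter_upwards [(tendsto_one_div_add_atTop_nhds_zero_nat (𝕜 := ℝ)).eventually (gt_mem_nhds hr)]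
    with j hj
  -- The room `r + r` around `K` is spent as one `r` for the mollification and one for the
  -- translation.
  have hsub : tsupport (mollify j φ) ⊆ Metric.cthickening r K :=
    (tsupport_mollify_subset hφK j).trans (Metric.cthickening_mono hj.le K)
  refine abs_setIntegral_mul_sub_le_of_contDiff hΩ hu hg hw (contDiff_mollify j hφi)
    (HasCompactSupport.of_support_subset_isCompact hK.cthickening
      ((subset_tsupport _).trans hsub)) (hb j) (fun z hz y hy => ?_) hh
  have h1 := hsub hy
  rw [hK.cthickening_eq_biUnion_closedBall hr.le, mem_iUnion₂] at h1
  obtain ⟨x, hxK, hx⟩ := h1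
  refine hKΩ (Metric.mem_cthickening_of_dist_le y x _ K hxK ?_)
  rw [Metric.mem_closedBall, dist_eq_norm] at hx
  rw [dist_eq_norm]
  calc ‖y - x‖ = ‖(y - z - x) + z‖ := by congr 1; abel
    _ ≤ _ := norm_add_le _ _
    _ ≤ r + r := add_le_add hx hz

/-- The translation estimate averaged over `h` against the mollifier. The rate `1 / (j + 1)` depends
on `φ` only through its bound, so `φ` may later vary with the sequence. -/
theorem abs_setIntegral_mul_mollify_sub_le (hΩ : MeasurableSet Ω) {u : Eu d → ℝ}
    {g : Fin d → Eu d → ℝ} (hu : IntegrableOn u Ω) (hg : ∀ i, IntegrableOn (g i) Ω)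
    (hw : ∀ i, IsWeakPartial Ω i u (g i)) {φ : Eu d → ℝ} (hφ : Measurable φ)
    {M r : ℝ} (hM : ∀ x, |φ x| ≤ M) {K : Set (Eu d)} (hK : IsCompact K) (hφK : ∀ x ∉ K, φ x = 0)
    (hr : 0 < r) (hKΩ : Metric.cthickening (r + r) K ⊆ Ω) {j : ℕ} (hj : 1 / ((j : ℝ) + 1) ≤ r) :
    |∫ y in Ω, u y * (mollify j φ y - φ y)| ≤
      M * (∑ i, ∫ y in Ω, |g i y|) * (1 / ((j : ℝ) + 1)) := by
  have hM0 : 0 ≤ M := (abs_nonneg _).trans (hM 0)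
  have hi : Integrable (fun p : Eu d × Eu d =>
      u p.1 * mollifier d j p.2 * (φ (p.1 - p.2) - φ p.1)) ((volume.restrict Ω).prod volume) :=
    (Integrable.mul_prod hu (integrable_mollifier j)).mul_bdd (c := M + M)
      ((hφ.comp (measurable_fst.sub measurable_snd)).sub
        (hφ.comp measurable_fst)).aestronglyMeasurable
      (ae_of_all _ fun p => (abs_sub _ _).trans (add_le_add (hM _) (hM _)))
  have hmi : ∀ y, Integrable fun h => mollifier d j h * φ (y - h) := fun y =>
    (integrable_mollifier j).mul_bdd (c := M)
      (hφ.comp (measurable_const.sub measurable_id)).aestronglyMeasurable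
      (ae_of_all _ fun h => hM _)
  have e : ∫ y in Ω, u y * (mollify j φ y - φ y) =
      ∫ h, mollifier d j h * ∫ y in Ω, u y * (φ (y - h) - φ y) := by
    calc ∫ y in Ω, u y * (mollify j φ y - φ y)
        = ∫ y in Ω, ∫ h, u y * mollifier d j h * (φ (y - h) - φ y) := by
          refine integral_congr_ae (ae_of_all _ fun y => ?_)
          have h1 : φ y = ∫ h, mollifier d j h * φ y := by
            rw [integral_mul_const, integral_mollifier, one_mul]
          change u y * (mollify j φ y - φ y) = _
          conv_lhs => rw [mollify_eq_swap, h1]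
          rw [← integral_sub (hmi y) ((integrable_mollifier j).mul_const _), ← integral_const_mul]
          refine integral_congr_ae (ae_of_all _ fun h => ?_)
          simp only
          ring
      _ = ∫ h, ∫ y in Ω, u y * mollifier d j h * (φ (y - h) - φ y) := integral_integral_swap hi
      _ = _ := by
          refine integral_congr_ae (ae_of_all _ fun h => ?_)
          simp only [← integral_const_mul]
          refine integral_congr_ae (ae_of_all _ fun y => ?_)
          simp only
          ring
  have hS : 0 ≤ M * ∑ i, ∫ y in Ω, |g i y| :=
    mul_nonneg hM0 (Finset.sum_nonneg fun i _ => integral_nonneg fun y => abs_nonneg _)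
  rw [e]
  have h := norm_integral_le_of_norm_le
    (f := fun h => mollifier d j h * ∫ y in Ω, u y * (φ (y - h) - φ y))
    ((integrable_mollifier (d := d) j).mul_const
      (M * (∑ i, ∫ y in Ω, |g i y|) * (1 / ((j : ℝ) + 1)))) (ae_of_all _ fun h => by
      rw [norm_mul, Real.norm_of_nonneg (mollifier_nonneg _ _)]
      by_cases hh : 1 / ((j : ℝ) + 1) < ‖h‖
      · simp [mollifier_eq_zero hh]
      · rw [not_lt] at hh
        refine mul_le_mul_of_nonneg_left ?_ (mollifier_nonneg _ _)
        exact (abs_setIntegral_mul_sub_le hΩ hu hg hw hφ hM hK hφK hr hKΩ (hh.trans hj)).trans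
          (mul_le_mul_of_nonneg_left hh hS))
  rwa [integral_mul_const, integral_mollifier, one_mul] at h

end WeakPartial

/-! ### Uniqueness of weak derivatives and the product rule -/

section Calculus

variable {d : ℕ} {Ω : Set (Eu d)}

theorem IsWeakPartial.congr_ae {F : Type*} [NormedAddCommGroup F] [NormedSpace ℝ F] {i : Fin d}
    {u u' g g' : Eu d → F} (h : IsWeakPartial Ω i u g)
    (hu : u =ᵐ[volume.restrict Ω] u') (hg : g =ᵐ[volume.restrict Ω] g') :
    IsWeakPartial Ω i u' g' := by
  intro φ h1 h2 h3
  have e1 : ∫ x in Ω, fderiv ℝ φ x (EuclideanSpace.single i 1) • u' x =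
      ∫ x in Ω, fderiv ℝ φ x (EuclideanSpace.single i 1) • u x :=
    integral_congr_ae (by filter_upwards [hu] with x hx; rw [hx])
  have e2 : ∫ x in Ω, φ x • g' x = ∫ x in Ω, φ x • g x :=
    integral_congr_ae (by filter_upwards [hg] with x hx; rw [hx])
  rw [e1, e2]
  exact h φ h1 h2 h3

theorem IsWeakPartial.unique {i : Fin d} {u g g' : Eu d → ℝ} (hΩ : IsOpen Ω)
    (h : IsWeakPartial Ω i u g) (h' : IsWeakPartial Ω i u g') (hg : IntegrableOn g Ω)
    (hg' : IntegrableOn g' Ω) : g =ᵐ[volume.restrict Ω] g' := by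
  have h0 := hΩ.ae_eq_zero_of_integral_contDiff_smul_eq_zero (μ := volume)
    (f := fun x => g x - g' x) (hg.sub hg').locallyIntegrableOn (fun φ h1 h2 h3 => by
      have e : ∫ x, φ x • (g x - g' x) = ∫ x in Ω, φ x • (g x - g' x) := by
        refine (setIntegral_eq_integral_of_forall_compl_eq_zero fun x hx => ?_).symm
        rw [image_eq_zero_of_notMem_tsupport fun hxt => hx (h3 hxt), zero_smul]
      have hi : ∀ {f : Eu d → ℝ}, IntegrableOn f Ω →
          Integrable (fun x => φ x • f x) (volume.restrict Ω) := fun hf =>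
        LocallyIntegrable.integrable_smul_left_of_hasCompactSupport
          (Integrable.locallyIntegrable hf) h1.continuous h2
      rw [e]
      simp only [smul_sub]
      rw [integral_sub (hi hg) (hi hg')]
      have := (h φ h1 h2 h3).symm.trans (h' φ h1 h2 h3)
      linarith [neg_inj.1 this])
  rw [Filter.EventuallyEq, ae_restrict_iff' hΩ.measurableSet]
  filter_upwards [h0] with x hx hxΩ
  exact sub_eq_zero.1 (hx hxΩ)

theorem IsWeakPartial.clm_comp {F : Type*} [NormedAddCommGroup F] [NormedSpace ℝ F]
    [CompleteSpace F] {i : Fin d} {u g : Eu d → F} (h : IsWeakPartial Ω i u g)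
    (hu : IntegrableOn u Ω) (hg : IntegrableOn g Ω) (T : F →L[ℝ] ℝ) :
    IsWeakPartial Ω i (fun x => T (u x)) (fun x => T (g x)) := by
  intro φ h1 h2 h3
  have hd : Continuous fun x => fderiv ℝ φ x (EuclideanSpace.single i 1) :=
    (h1.continuous_fderiv (by simp)).clm_apply continuous_const
  have hdc : HasCompactSupport fun x => fderiv ℝ φ x (EuclideanSpace.single i 1) :=
    h2.fderiv_apply (𝕜 := ℝ) _
  have i1 := LocallyIntegrable.integrable_smul_left_of_hasCompactSupport
    (Integrable.locallyIntegrable hu) hd hdc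
  have i2 := LocallyIntegrable.integrable_smul_left_of_hasCompactSupport
    (Integrable.locallyIntegrable hg) h1.continuous h2
  simp only [← map_smul]
  rw [T.integral_comp_comm i1, T.integral_comp_comm i2, h φ h1 h2 h3, map_neg]

/-- The product rule for bounded functions. -/
theorem IsWeakPartial.mul (hΩ : IsOpen Ω) [IsFiniteMeasure (volume.restrict Ω)] {i : Fin d}
    {u v f g : Eu d → ℝ} (hu : UnitBounded (volume.restrict Ω) u)
    (hv : UnitBounded (volume.restrict Ω) v) (hf : IntegrableOn f Ω) (hg : IntegrableOn g Ω)
    (hwu : IsWeakPartial Ω i u f) (hwv : IsWeakPartial Ω i v g) :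
    IsWeakPartial Ω i (fun x => u x * v x) (fun x => u x * g x + v x * f x) := by
  intro φ h1 h2 h3
  set e : Eu d := EuclideanSpace.single i 1 with he
  have hΩm := hΩ.measurableSet
  obtain ⟨r, hr, hrΩ⟩ := h2.isCompact.exists_cthickening_subset_open hΩ h3
  obtain ⟨C, hC⟩ := h2.exists_bound_of_continuous h1.continuous
  have hd : Continuous fun x => fderiv ℝ φ x e :=
    (h1.continuous_fderiv (by simp)).clm_apply continuous_const
  have hdc : HasCompactSupport fun x => fderiv ℝ φ x e := h2.fderiv_apply (𝕜 := ℝ) _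
  have hdi : Integrable (fun x => fderiv ℝ φ x e) (volume.restrict Ω) :=
    (hd.integrable_of_hasCompactSupport hdc).restrict
  -- Extensions by zero. The scheme is to test the weak derivative of `u` with `φ` times the
  -- mollified `V`, then remove the mollification.
  set V : Eu d → ℝ := Ω.indicator v with hV
  set G : Eu d → ℝ := Ω.indicator g with hG
  set A : Eu d → ℝ := Ω.indicator (fun x => φ x * u x) with hA
  have hVi : Integrable V := IntegrableOn.integrable_indicator hv.integrable hΩm
  have hGi : Integrable G := IntegrableOn.integrable_indicator hg hΩm
  have hui : Integrable u (volume.restrict Ω) := hu.integrable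
  have hφu : Integrable (fun x => φ x * u x) (volume.restrict Ω) :=
    hui.bdd_mul h1.continuous.aestronglyMeasurable (ae_of_all _ hC)
  have hAi : Integrable A := IntegrableOn.integrable_indicator hφu hΩm
  have hVb : ∀ᵐ x, |V x| ≤ 1 := by
    have h := (ae_restrict_iff' hΩm).1 hv.2
    filter_upwards [h] with x hx
    by_cases hxΩ : x ∈ Ω
    · simpa [hV, hxΩ] using hx hxΩ
    · simp [hV, hxΩ]
  have hC0 : 0 ≤ C := (norm_nonneg _).trans (hC 0)
  have hAb : ∀ᵐ x, |A x| ≤ C := by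
    have h := (ae_restrict_iff' hΩm).1 hu.2
    filter_upwards [h] with x hx
    by_cases hxΩ : x ∈ Ω
    · simp only [hA, hxΩ, indicator_of_mem, abs_mul]
      exact (mul_le_of_le_one_right (abs_nonneg _) (hx hxΩ)).trans (hC x)
    · simpa [hA, hxΩ] using hC0
  have hVlim : ∀ᵐ x ∂volume.restrict Ω,
      Tendsto (fun j => mollify j V x) atTop (𝓝 (v x)) := by
    filter_upwards [ae_restrict_of_ae (ae_tendsto_mollify hVi), ae_restrict_mem hΩm] with x hx hxΩ
    simpa [hV, hxΩ] using hx
  have hVc : ∀ j, Continuous (mollify j V) := fun j => (contDiff_mollify j hVi).continuous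
  have hAc : ∀ j, Continuous (mollify j A) := fun j => (contDiff_mollify j hAi).continuous
  have hGc : ∀ j, Continuous (mollify j G) := fun j => (contDiff_mollify j hGi).continuous
  have t1 : Tendsto (fun j => ∫ x in Ω, fderiv ℝ φ x e * mollify j V x * u x) atTop
      (𝓝 (∫ x in Ω, fderiv ℝ φ x e * v x * u x)) := by
    refine tendsto_integral_of_dominated_convergence (fun x => |fderiv ℝ φ x e|)
      (fun j => (hd.mul (hVc j)).aestronglyMeasurable.mul hu.1) hdi.abs (fun j => ?_) ?_
    · filter_upwards [hu.2] with x hx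
      rw [norm_mul, norm_mul, mul_assoc, Real.norm_eq_abs]
      exact mul_le_of_le_one_right (abs_nonneg _)
        (mul_le_one₀ (abs_mollify_le hVb j x) (norm_nonneg _) hx)
    · filter_upwards [hVlim] with x hx
      exact (hx.const_mul _).mul_const _
  -- The mollifier sits on the bounded function `A` rather than on the merely integrable `G`, so
  -- dominated convergence applies; self-adjointness justifies the exchange.
  have t2 : Tendsto (fun j => ∫ x, G x * mollify j A x) atTop (𝓝 (∫ x, G x * A x)) := by
    refine tendsto_integral_of_dominated_convergence (fun x => |G x| * C)
      (fun j => hGi.1.mul (hAc j).aestronglyMeasurable) (hGi.abs.mul_const _)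
      (fun j => ae_of_all _ fun x => ?_) ?_
    · rw [norm_mul]
      exact mul_le_mul_of_nonneg_left (abs_mollify_le hAb j x) (norm_nonneg _)
    · filter_upwards [ae_tendsto_mollify hAi] with x hx
      exact hx.const_mul _
  have t3 : Tendsto (fun j => ∫ x in Ω, φ x * mollify j V x * f x) atTop
      (𝓝 (∫ x in Ω, φ x * v x * f x)) := by
    refine tendsto_integral_of_dominated_convergence (fun x => C * |f x|)
      (fun j => (h1.continuous.mul (hVc j)).aestronglyMeasurable.mul hf.1) (hf.abs.const_mul _)
      (fun j => ae_of_all _ fun x => ?_) ?_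
    · rw [norm_mul, norm_mul, Real.norm_eq_abs (f x)]
      refine mul_le_mul_of_nonneg_right ?_ (abs_nonneg _)
      exact (mul_le_of_le_one_right (norm_nonneg _) (abs_mollify_le hVb j x)).trans (hC x)
    · filter_upwards [hVlim] with x hx
      exact (hx.const_mul _).mul_const _
  -- Once the mollification radius is below `r`, differentiating the mollified `V` on the support of
  -- `φ` gives the mollified `G`: the jump of `V` across the boundary of `Ω` is not seen there.
  have hev : ∀ᶠ j : ℕ in atTop, (∫ x in Ω, fderiv ℝ φ x e * mollify j V x * u x) +
      ∫ x, G x * mollify j A x = -∫ x in Ω, φ x * mollify j V x * f x := by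
    filter_upwards [(tendsto_one_div_add_atTop_nhds_zero_nat (𝕜 := ℝ)).eventually (gt_mem_nhds hr)]
      with j hj
    have hVs := contDiff_mollify j hVi
    have hVeq : mollify j V = fun x => ∫ y in Ω, v y * mollifier d j (x - y) := by
      funext x
      rw [mollify, ← integral_indicator hΩm]
      refine integral_congr_ae (ae_of_all _ fun y => ?_)
      by_cases hy : y ∈ Ω <;> simp [hV, hy]
    have hGeq : ∀ x, mollify j G x = ∫ y in Ω, g y * mollifier d j (x - y) := fun x => by
      rw [mollify, ← integral_indicator hΩm]
      refine integral_congr_ae (ae_of_all _ fun y => ?_)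
      by_cases hy : y ∈ Ω <;> simp [hG, hy]
    have hder : ∀ x, φ x * fderiv ℝ (mollify j V) x e = φ x * mollify j G x := fun x => by
      by_cases hx : x ∈ tsupport φ
      · have hD := hasFDerivAt_setIntegral_mul_sub hΩm hv.integrable (contDiff_mollifier j)
          (hasCompactSupport_mollifier j) x
        rw [hVeq, hD.fderiv, hGeq, hwv.setIntegral_smul_fderiv_sub hv.integrable
          (contDiff_mollifier j) (hasCompactSupport_mollifier j) x fun y hy => ?_]
        rw [tsupport_mollifier, mem_closedBall_zero_iff] at hy
        refine hrΩ (Metric.mem_cthickening_of_dist_le y x _ _ hx ?_)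
        rw [dist_comm, dist_eq_norm]
        linarith
      · simp [image_eq_zero_of_notMem_tsupport hx]
    have hw := hwu (fun x => φ x * mollify j V x) (h1.mul hVs) h2.mul_right
      ((tsupport_mul_subset_left).trans h3)
    have hpt : ∀ x, fderiv ℝ (fun x => φ x * mollify j V x) x e • u x =
        fderiv ℝ φ x e * mollify j V x * u x + φ x * u x * mollify j G x := fun x => by
      have hφd : DifferentiableAt ℝ φ x := (h1.differentiable (by simp)) x
      have hVd : DifferentiableAt ℝ (mollify j V) x := (hVs.differentiable (by simp)) x
      have h5 := (hφd.hasFDerivAt.mul hVd.hasFDerivAt).fderiv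
      have h6 : fderiv ℝ (fun x => φ x * mollify j V x) x e =
          φ x * fderiv ℝ (mollify j V) x e + mollify j V x * fderiv ℝ φ x e := by
        rw [show (fun x => φ x * mollify j V x) = φ * mollify j V from rfl, h5]
        simp
      rw [h6, hder, smul_eq_mul]
      ring
    have i1 : Integrable (fun x => fderiv ℝ φ x e * mollify j V x * u x) (volume.restrict Ω) := by
      have := hui.mul_bdd (c := 1) (f := u) ((hVc j).aestronglyMeasurable)
        (ae_of_all _ fun x => abs_mollify_le hVb j x)
      obtain ⟨C', hC'⟩ := hdc.exists_bound_of_continuous hd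
      refine (this.bdd_mul (c := C') hd.aestronglyMeasurable (ae_of_all _ hC')).congr
        (ae_of_all _ fun x => ?_)
      simp only
      ring
    have hGm : ∫ x, A x * mollify j G x = ∫ x in Ω, φ x * u x * mollify j G x := by
      rw [← integral_indicator hΩm]
      refine integral_congr_ae (ae_of_all _ fun y => ?_)
      by_cases hy : y ∈ Ω <;> simp [hA, hy]
    have i2 : Integrable (fun x => φ x * u x * mollify j G x) (volume.restrict Ω) := by
      have hs : HasCompactSupport fun x => φ x * mollify j G x := h2.mul_right
      obtain ⟨C', hC'⟩ := hs.exists_bound_of_continuous (h1.continuous.mul (hGc j))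
      refine (hui.bdd_mul (c := C') (h1.continuous.mul (hGc j)).aestronglyMeasurable
        (ae_of_all _ hC')).congr (ae_of_all _ fun x => ?_)
      simp only [Pi.mul_apply]
      ring
    simp only [← he] at hw
    rw [integral_congr_ae (ae_of_all _ hpt), integral_add i1 i2, ← hGm,
      integral_mul_mollify_comm hAi hGi] at hw
    exact hw
  have hfin := tendsto_nhds_unique_of_eventuallyEq (t1.add t2) t3.neg hev
  have hGA : ∫ x, G x * A x = ∫ x in Ω, φ x * u x * g x := by
    rw [← integral_indicator hΩm]
    refine integral_congr_ae (ae_of_all _ fun y => ?_)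
    by_cases hy : y ∈ Ω
    · simp only [hG, hA, hy, indicator_of_mem]
      ring
    · simp [hG, hy]
  rw [hGA] at hfin
  have j1 : Integrable (fun x => φ x * u x * g x) (volume.restrict Ω) := by
    refine ((hu.integrable_mul hg).bdd_mul (c := C) h1.continuous.aestronglyMeasurable
      (ae_of_all _ hC)).congr (ae_of_all _ fun x => ?_)
    simp only
    ring
  have j2 : Integrable (fun x => φ x * v x * f x) (volume.restrict Ω) := by
    refine ((hv.integrable_mul hf).bdd_mul (c := C) h1.continuous.aestronglyMeasurable
      (ae_of_all _ hC)).congr (ae_of_all _ fun x => ?_)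
    simp only
    ring
  have k1 : ∫ x in Ω, φ x • (u x * g x + v x * f x) =
      (∫ x in Ω, φ x * u x * g x) + ∫ x in Ω, φ x * v x * f x := by
    rw [← integral_add j1 j2]
    refine integral_congr_ae (ae_of_all _ fun x => ?_)
    simp only [smul_eq_mul]
    ring
  have k2 : ∫ x in Ω, fderiv ℝ φ x e • (u x * v x) = ∫ x in Ω, fderiv ℝ φ x e * v x * u x := by
    refine integral_congr_ae (ae_of_all _ fun x => ?_)
    simp only [smul_eq_mul]
    ring
  rw [k1, k2]
  linarith

end Calculus

/-! ### Closure properties of weak limits and bounded representatives -/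

section Compactness

variable {α : Type*} {m : MeasurableSpace α} {μ : Measure α}

theorem WeakL1.congr_ae {g f : ℕ → α → ℝ} {g' f' : α → ℝ} (h : WeakL1 μ g g')
    (h1 : ∀ k, g k =ᵐ[μ] f k) (h2 : g' =ᵐ[μ] f') : WeakL1 μ f f' := by
  intro w hw
  have h3 := h w hw
  rw [integral_congr_ae (g := fun x => w x * f' x)
    (by filter_upwards [h2] with x hx; rw [hx])] at h3
  refine h3.congr fun k => integral_congr_ae ?_
  filter_upwards [h1 k] with x hx
  rw [hx]

theorem WeakL1.tendsto_of_bounded {g : ℕ → α → ℝ} {g' : α → ℝ} (h : WeakL1 μ g g') {w : α → ℝ}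
    (hw : AEStronglyMeasurable w μ) {C : ℝ} (hC : ∀ᵐ x ∂μ, |w x| ≤ C) :
    Tendsto (fun k => ∫ x, w x * g k x ∂μ) atTop (𝓝 (∫ x, w x * g' x ∂μ)) := by
  set c : ℝ := |C| + 1 with hc
  have hc0 : 0 < c := by positivity
  have hwb : UnitBounded μ fun x => c⁻¹ * w x := by
    refine ⟨hw.const_mul _, ?_⟩
    filter_upwards [hC] with x hx
    rw [abs_mul, abs_inv, abs_of_pos hc0, inv_mul_le_one₀ hc0]
    linarith [le_abs_self C]
  have h1 := (h _ hwb).const_mul c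
  simp only [← integral_const_mul] at h1
  convert h1 using 2 with k
  · refine integral_congr_ae (ae_of_all _ fun x => ?_)
    simp only
    field_simp
  · congr 1
    funext x
    field_simp

/-- Testing against indicators bounds the integral of `g'` over every measurable set by its measure,
from both sides. -/
theorem WeakL1.unitBounded [IsFiniteMeasure μ] {g : ℕ → α → ℝ} {g' : α → ℝ} (h : WeakL1 μ g g')
    (hg : ∀ k, UnitBounded μ (g k)) (hg' : Integrable g' μ) : UnitBounded μ g' := by
  have key : ∀ s, MeasurableSet s → |∫ x in s, g' x ∂μ| ≤ ∫ _ in s, (1 : ℝ) ∂μ := by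
    intro s hs
    have hind : UnitBounded μ (s.indicator fun _ => (1 : ℝ)) :=
      ⟨aestronglyMeasurable_const.indicator hs, ae_of_all _ fun x => by
        by_cases hx : x ∈ s <;> simp [hx]⟩
    have e : ∀ f : α → ℝ, ∫ x, s.indicator (fun _ => (1 : ℝ)) x * f x ∂μ = ∫ x in s, f x ∂μ := by
      intro f
      rw [← integral_indicator hs]
      refine integral_congr_ae (ae_of_all _ fun x => ?_)
      by_cases hx : x ∈ s <;> simp [hx]
    have h1 := h _ hind
    simp only [e] at h1
    refine le_of_tendsto' h1.abs fun k => ?_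
    rw [← Real.norm_eq_abs]
    exact norm_integral_le_of_norm_le (integrable_const _) (ae_restrict_of_ae (hg k).2)
  have h1 : g' ≤ᵐ[μ] fun _ => 1 := ae_le_of_forall_setIntegral_le hg' (integrable_const _)
    fun s hs _ => (abs_le.1 (key s hs)).2
  have h2 : (fun x => -g' x) ≤ᵐ[μ] fun _ => 1 :=
    ae_le_of_forall_setIntegral_le hg'.neg (integrable_const _) fun s hs _ => by
      have := (abs_le.1 (key s hs)).1
      rw [integral_neg]
      linarith
  refine ⟨hg'.1, ?_⟩
  filter_upwards [h1, h2] with x h3 h4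
  exact abs_le.2 ⟨by linarith, h3⟩

/-- Truncating a measurable representative provides the pointwise bounds and genuine measurability
that the translation estimates require. -/
theorem UnitBounded.exists_measurable {h : α → ℝ} (hh : UnitBounded μ h) :
    ∃ f : α → ℝ, Measurable f ∧ (∀ x, |f x| ≤ 1) ∧ h =ᵐ[μ] f := by
  refine ⟨fun x => max (-1) (min 1 (hh.1.mk h x)), measurable_const.max
    (measurable_const.min hh.1.stronglyMeasurable_mk.measurable), fun x => ?_, ?_⟩
  · exact abs_le.2 ⟨le_max_left _ _, max_le (by norm_num) (min_le_left _ _)⟩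
  · filter_upwards [hh.2, hh.1.ae_eq_mk] with x h1 h2
    rw [← h2]
    obtain ⟨h3, h4⟩ := abs_le.1 h1
    rw [min_eq_right h4, max_eq_right h3]

end Compactness

/-! ### Rellich-type compactness for bounded sequences -/

section Rellich

variable {d : ℕ} {Ω : Set (Eu d)}

/-- Convergence of the squared `L²` norms on `K`. For fixed `j`, mollification turns weak
convergence into pointwise convergence and the product lemma applies; the mollification error is at
most `C / (j + 1)`, uniformly in large `k`, by the translation estimate with `φ` the truncation of
`u k` to `K`. -/
theorem tendsto_setIntegral_mul_indicator (hΩ : IsOpen Ω) [IsFiniteMeasure (volume.restrict Ω)]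
    {u : ℕ → Eu d → ℝ} {u' : Eu d → ℝ} (hum : ∀ k, Measurable (u k)) (hub : ∀ k x, |u k x| ≤ 1)
    (hum' : Measurable u') (hub' : ∀ x, |u' x| ≤ 1) {g : ℕ → Fin d → Eu d → ℝ}
    (hg : ∀ k i, IntegrableOn (g k i) Ω) (hw : ∀ k i, IsWeakPartial Ω i (u k) (g k i)) {C : ℝ}
    (hC : ∀ᶠ k in atTop, ∑ i, ∫ x in Ω, |g k i x| ≤ C)
    (hweak : WeakL1 (volume.restrict Ω) u u') {K : Set (Eu d)} (hK : IsCompact K) (hKΩ : K ⊆ Ω) :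
    Tendsto (fun k => ∫ x in Ω, u k x * K.indicator (u k) x) atTop
      (𝓝 (∫ x in Ω, u' x * K.indicator u' x)) := by
  have hKm := hK.measurableSet
  have hΩm := hΩ.measurableSet
  have hind : ∀ {f : Eu d → ℝ}, (∀ x, |f x| ≤ 1) → ∀ x, |K.indicator f x| ≤ 1 := by
    intro f hf x
    by_cases hx : x ∈ K
    · simpa [hx] using hf x
    · simp [hx]
  have hindm : ∀ {f : Eu d → ℝ}, Measurable f → (∀ x, |f x| ≤ 1) → Integrable (K.indicator f) :=
    fun hf hb => IntegrableOn.integrable_indicator (Measure.integrableOn_of_bounded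
      hK.measure_lt_top.ne hf.aestronglyMeasurable (ae_of_all _ hb)) hKm
  have hub1 : ∀ k, UnitBounded (volume.restrict Ω) (u k) := fun k =>
    ⟨(hum k).aestronglyMeasurable, ae_of_all _ (hub k)⟩
  have hub1' : UnitBounded (volume.restrict Ω) u' :=
    ⟨hum'.aestronglyMeasurable, ae_of_all _ hub'⟩
  have hmb : ∀ {f : Eu d → ℝ}, Measurable f → (∀ x, |f x| ≤ 1) → ∀ j,
      UnitBounded (volume.restrict Ω) (mollify j (K.indicator f)) := fun hf hb j =>
    ⟨(contDiff_mollify j (hindm hf hb)).continuous.aestronglyMeasurable,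
      ae_of_all _ fun x => abs_mollify_le (ae_of_all _ (hind hb)) j x⟩
  obtain ⟨r', hr', hrΩ⟩ := hK.exists_cthickening_subset_open hΩ hKΩ
  have hr : 0 < r' / 2 := half_pos hr'
  have hlimk : ∀ j, Tendsto (fun k => ∫ x in Ω, mollify j (K.indicator (u k)) x * u k x) atTop
      (𝓝 (∫ x in Ω, mollify j (K.indicator u') x * u' x)) := by
    intro j
    refine hweak.tendsto_integral_mul (fun k => (hub1 k).integrable) hub1'.integrable
      (fun k => hmb (hum k) (hub k) j) (hmb hum' hub' j) (ae_of_all _ fun x => ?_)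
    obtain ⟨c, hc⟩ := (hasCompactSupport_mollifier (d := d) j).exists_bound_of_continuous
      (continuous_mollifier j)
    have hc0 : 0 ≤ c := (norm_nonneg _).trans (hc 0)
    have h1 := hweak.tendsto_of_bounded
      (w := K.indicator fun y => mollifier d j (x - y)) (C := c)
      (((continuous_mollifier j).comp (continuous_sub_left x)).aestronglyMeasurable.indicator hKm)
      (ae_of_all _ fun y => by
        by_cases hy : y ∈ K
        · simpa [hy] using hc (x - y)
        · simpa [hy] using hc0)
    have e : ∀ f : Eu d → ℝ, ∫ y in Ω, K.indicator (fun y => mollifier d j (x - y)) y * f y =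
        mollify j (K.indicator f) x := fun f => by
      rw [mollify, ← integral_indicator hΩm]
      refine integral_congr_ae (ae_of_all _ fun y => ?_)
      by_cases hy : y ∈ K
      · simp [hy, hKΩ hy, mul_comm]
      · by_cases hy' : y ∈ Ω <;> simp [hy, hy']
    simpa only [e] using h1
  have hlimj : Tendsto (fun j => ∫ x in Ω, mollify j (K.indicator u') x * u' x) atTop
      (𝓝 (∫ x in Ω, u' x * K.indicator u' x)) := by
    refine tendsto_integral_of_dominated_convergence (fun _ => 1)
      (fun j => ((hmb hum' hub' j).mul hub1').1) (integrable_const _)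
      (fun j => ((hmb hum' hub' j).mul hub1').2) ?_
    filter_upwards [ae_restrict_of_ae (ae_tendsto_mollify (hindm hum' hub'))] with x hx
    rw [mul_comm (u' x)]
    exact hx.mul_const _
  have hest : ∀ᶠ k in atTop, ∀ j : ℕ, 1 / ((j : ℝ) + 1) ≤ r' / 2 →
      |(∫ x in Ω, mollify j (K.indicator (u k)) x * u k x) -
        ∫ x in Ω, u k x * K.indicator (u k) x| ≤ C * (1 / ((j : ℝ) + 1)) := by
    filter_upwards [hC] with k hk j hj
    have h1 := abs_setIntegral_mul_mollify_sub_le hΩm (hub1 k).integrable (hg k) (hw k)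
      ((hum k).indicator hKm) (hind (hub k)) hK (fun x hx => indicator_of_notMem hx _) hr
      (by rwa [add_halves]) hj
    have i1 := (hmb (hum k) (hub k) j).integrable_mul (hub1 k).integrable
    have i2 : Integrable (fun x => u k x * K.indicator (u k) x) (volume.restrict Ω) :=
      (hub1 k).integrable_mul (hindm (hum k) (hub k)).restrict
    rw [← integral_sub i1 i2]
    calc _ = |∫ y in Ω, u k y * (mollify j (K.indicator (u k)) y - K.indicator (u k) y)| := by
          congr 2
          funext y
          ring
      _ ≤ _ := h1
      _ ≤ _ := by
          rw [one_mul]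
          exact mul_le_mul_of_nonneg_right hk (by positivity)
  refine Metric.tendsto_atTop.2 fun ε hε => ?_
  have h0 := tendsto_one_div_add_atTop_nhds_zero_nat (𝕜 := ℝ)
  have hε3 : 0 < ε / 3 := by positivity
  have hc1 : ∀ᶠ j : ℕ in atTop, C * (1 / ((j : ℝ) + 1)) < ε / 3 :=
    (by simpa using h0.const_mul C : Tendsto (fun j : ℕ => C * (1 / ((j : ℝ) + 1))) atTop
      (𝓝 0)).eventually (gt_mem_nhds hε3)
  obtain ⟨j, hj1, hj2, hj3⟩ := (hc1.and ((h0.eventually (gt_mem_nhds hr)).and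
    ((Metric.tendsto_nhds.1 hlimj) _ hε3))).exists
  obtain ⟨N, hN⟩ := eventually_atTop.1 (hest.and ((Metric.tendsto_nhds.1 (hlimk j)) _ hε3))
  refine ⟨N, fun k hk => ?_⟩
  obtain ⟨h1, h2⟩ := hN k hk
  have h3 := h1 j hj2.le
  rw [← Real.dist_eq] at h3
  rw [dist_comm] at h3
  exact (dist_triangle4 _ _ _ _).trans_lt (add_lt_add (add_lt_add (h3.trans_lt hj1) h2) hj3)
    |>.trans_eq (by ring)

/-- On a compact `K ⊆ Ω`, weak convergence together with convergence of norms gives strong `L²`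
convergence; uniform boundedness makes `Ω \ K` negligible once its measure is small. -/
theorem tendsto_setIntegral_sq_sub_of_measurable (hΩ : IsOpen Ω)
    [IsFiniteMeasure (volume.restrict Ω)]
    {u : ℕ → Eu d → ℝ} {u' : Eu d → ℝ} (hum : ∀ k, Measurable (u k)) (hub : ∀ k x, |u k x| ≤ 1)
    (hum' : Measurable u') (hub' : ∀ x, |u' x| ≤ 1) {g : ℕ → Fin d → Eu d → ℝ}
    (hg : ∀ k i, IntegrableOn (g k i) Ω) (hw : ∀ k i, IsWeakPartial Ω i (u k) (g k i)) {C : ℝ}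
    (hC : ∀ᶠ k in atTop, ∑ i, ∫ x in Ω, |g k i x| ≤ C)
    (hweak : WeakL1 (volume.restrict Ω) u u') :
    Tendsto (fun k => ∫ x in Ω, (u k x - u' x) ^ 2) atTop (𝓝 0) := by
  have hub1 : ∀ k, UnitBounded (volume.restrict Ω) (u k) := fun k =>
    ⟨(hum k).aestronglyMeasurable, ae_of_all _ (hub k)⟩
  have hub1' : UnitBounded (volume.restrict Ω) u' :=
    ⟨hum'.aestronglyMeasurable, ae_of_all _ hub'⟩
  have hsq : ∀ k x, (u k x - u' x) ^ 2 ≤ 4 := fun k x => by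
    obtain ⟨h1, h2⟩ := abs_le.1 (hub k x)
    obtain ⟨h3, h4⟩ := abs_le.1 (hub' x)
    nlinarith
  have hsqi : ∀ k, Integrable (fun x => (u k x - u' x) ^ 2) (volume.restrict Ω) := fun k =>
    Integrable.of_bound (((hum k).sub hum').pow_const 2).aestronglyMeasurable 4
      (ae_of_all _ fun x => by
        rw [Real.norm_of_nonneg (sq_nonneg _)]
        exact hsq k x)
  refine Metric.tendsto_atTop.2 fun ε hε => ?_
  have hfin : volume Ω ≠ ⊤ := by
    rw [← Measure.restrict_apply_univ]
    exact measure_ne_top _ _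
  -- The integrand is at most `4`, so measure `ε / 8` outside `K` costs `ε / 2`.
  obtain ⟨K, hKΩ, hK, hKε⟩ := hΩ.measurableSet.exists_isCompact_sdiff_lt (μ := volume) hfin
    (ε := ENNReal.ofReal (ε / 8)) (by simpa using (by positivity : 0 < ε / 8))
  have hKm := hK.measurableSet
  have hbi : ∀ {f : Eu d → ℝ}, UnitBounded (volume.restrict Ω) f →
      UnitBounded (volume.restrict Ω) (K.indicator f) := by
    intro f hf
    refine ⟨hf.1.indicator hKm, ?_⟩
    filter_upwards [hf.2] with x hx
    by_cases hxK : x ∈ K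
    · simpa [hxK] using hx
    · simp [hxK]
  have h1 := tendsto_setIntegral_mul_indicator hΩ hum hub hum' hub' hg hw hC hweak hK hKΩ
  have h2 := hweak _ (hbi hub1')
  have h3 : Tendsto (fun k => ∫ x in Ω, K.indicator (fun x => (u k x - u' x) ^ 2) x) atTop
      (𝓝 0) := by
    have h4 := (h1.sub (h2.const_mul 2)).add_const (∫ x in Ω, u' x * K.indicator u' x)
    have e0 : ∫ x in Ω, K.indicator u' x * u' x = ∫ x in Ω, u' x * K.indicator u' x :=
      integral_congr_ae (ae_of_all _ fun x => mul_comm _ _)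
    rw [e0, show ∀ a : ℝ, a - 2 * a + a = 0 from fun a => by ring] at h4
    refine h4.congr fun k => ?_
    have i1 := ((hub1 k).mul (hbi (hub1 k))).integrable
    have i2 := ((hbi hub1').mul (hub1 k)).integrable
    have i3 := (hub1'.mul (hbi hub1')).integrable
    have i4 : Integrable (fun x => u k x * K.indicator (u k) x - 2 * (K.indicator u' x * u k x))
      (volume.restrict Ω) := i1.sub (i2.const_mul 2)
    rw [← integral_const_mul, ← integral_sub i1 (i2.const_mul 2), ← integral_add i4 i3]
    refine integral_congr_ae (ae_of_all _ fun x => ?_)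
    by_cases hx : x ∈ K
    · simp only [hx, indicator_of_mem]
      ring
    · simp [hx]
  obtain ⟨N, hN⟩ := eventually_atTop.1 (h3.eventually (gt_mem_nhds (half_pos hε)))
  refine ⟨N, fun k hk => ?_⟩
  rw [Real.dist_eq, sub_zero, abs_of_nonneg (integral_nonneg fun x => sq_nonneg _)]
  have j1 : Integrable (K.indicator fun x => (u k x - u' x) ^ 2) (volume.restrict Ω) :=
    (hsqi k).indicator hKm
  have j2 : Integrable (Kᶜ.indicator fun _ => (4 : ℝ)) (volume.restrict Ω) :=
    (integrable_const _).indicator hKm.compl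
  have h5 : ∫ x in Ω, (u k x - u' x) ^ 2 ≤
      ∫ x in Ω, (K.indicator (fun x => (u k x - u' x) ^ 2) x + Kᶜ.indicator (fun _ => 4) x) := by
    refine integral_mono (hsqi k) (j1.add j2) fun x => ?_
    by_cases hx : x ∈ K
    · simp [hx]
    · simpa [hx] using hsq k x
  rw [integral_add j1 j2, integral_indicator hKm.compl, Measure.restrict_restrict hKm.compl,
    integral_const, smul_eq_mul] at h5
  have h6 : (volume.restrict (Kᶜ ∩ Ω)).real univ < ε / 8 := by
    rw [measureReal_restrict_apply_univ, inter_comm, ← Set.sdiff_eq]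
    exact ENNReal.toReal_lt_of_lt_ofReal hKε
  linarith [hN k hk]

/-- Local compactness of bounded sequences with bounded gradients. -/
theorem tendsto_setIntegral_sq_sub (hΩ : IsOpen Ω) [IsFiniteMeasure (volume.restrict Ω)]
    {u : ℕ → Eu d → ℝ} {u' : Eu d → ℝ} (hub : ∀ k, UnitBounded (volume.restrict Ω) (u k))
    (hub' : UnitBounded (volume.restrict Ω) u') {g : ℕ → Fin d → Eu d → ℝ}
    (hg : ∀ k i, IntegrableOn (g k i) Ω) (hw : ∀ k i, IsWeakPartial Ω i (u k) (g k i)) {C : ℝ}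
    (hC : ∀ᶠ k in atTop, ∑ i, ∫ x in Ω, |g k i x| ≤ C)
    (hweak : WeakL1 (volume.restrict Ω) u u') :
    Tendsto (fun k => ∫ x in Ω, (u k x - u' x) ^ 2) atTop (𝓝 0) := by
  choose f hfm hfb hfe using fun k => (hub k).exists_measurable
  obtain ⟨f', hfm', hfb', hfe'⟩ := hub'.exists_measurable
  refine (tendsto_setIntegral_sq_sub_of_measurable hΩ hfm hfb hfm' hfb' hg
    (fun k i => (hw k i).congr_ae (hfe k) .rfl) hC (hweak.congr_ae hfe hfe')).congr fun k => ?_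
  refine integral_congr_ae ?_
  filter_upwards [hfe k, hfe'] with x h1 h2
  rw [h1, h2]

theorem exists_weak_limit {μ : Measure (Eu d)} [IsFiniteMeasure μ] {n : ℕ → Eu d → Eu 3}
    (hm : ∀ k, AEStronglyMeasurable (n k) μ) (hb : ∀ k, ∀ᵐ x ∂μ, ‖n k x‖ ≤ 1) :
    ∃ n' : Eu d → Eu 3, ∃ ns : ℕ → ℕ, StrictMono ns ∧ Integrable n' μ ∧
      ∀ a, WeakL1 μ (fun k x => n (ns k) x a) (fun x => n' x a) := by
  have hn : ∀ k, MemLp (n k) 2 μ := fun k => MemLp.of_bound (hm k) 1 (hb k)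
  -- Supplies separability of `L²`, needed for the sequential form of Banach–Alaoglu.
  have : Fact ((2 : ℝ≥0∞) ≠ ⊤) := ⟨by simp⟩
  let N : ℕ → (Lp (Eu 3) 2 μ) := fun k => (hn k).toLp (n k)
  obtain ⟨R, hR⟩ : ∃ R : ℝ, ∀ k, ‖N k‖ ≤ R := by
    refine ⟨_, fun k => Lp.norm_le_of_ae_bound (C := 1) zero_le_one ?_⟩
    filter_upwards [(hn k).coeFn_toLp, hb k] with x h1 h2
    rwa [h1]
  let ℓ : ℕ → WeakDual ℝ (Lp (Eu 3) 2 μ) := fun k =>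
    StrongDual.toWeakDual (InnerProductSpace.toDual ℝ (Lp (Eu 3) 2 μ) (N k))
  have hseq := WeakDual.isSeqCompact_closedBall ℝ (Lp (Eu 3) 2 μ) 0 R
  obtain ⟨ℓ', -, ns, hns, hlim⟩ := hseq (x := ℓ) (fun k => by
    rw [mem_preimage, mem_closedBall_zero_iff]
    change ‖InnerProductSpace.toDual ℝ (Lp (Eu 3) 2 μ) (N k)‖ ≤ R
    rw [LinearIsometryEquiv.norm_map]
    exact hR k)
  let N' : (Lp (Eu 3) 2 μ) :=
    (InnerProductSpace.toDual ℝ (Lp (Eu 3) 2 μ)).symm (WeakDual.toStrongDual ℓ')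
  have hlim' : ∀ H : (Lp (Eu 3) 2 μ),
      Tendsto (fun k => inner ℝ (N (ns k)) H) atTop (𝓝 (inner ℝ N' H)) := by
    intro H
    have h1 := ((WeakDual.eval_continuous H).tendsto ℓ').comp hlim
    have e : inner ℝ N' H = ℓ' H := InnerProductSpace.toDual_symm_apply
    rw [e]
    exact h1
  refine ⟨N', ns, hns, (Lp.memLp N').integrable one_le_two, fun a h hh => ?_⟩
  have hH : MemLp (fun x => (EuclideanSpace.single a (h x) : Eu 3)) 2 μ := by
    refine MemLp.of_bound ?_ 1 ?_
    · have h1 : Continuous fun t : ℝ => (EuclideanSpace.single a t : Eu 3) :=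
        (PiLp.continuous_toLp 2 _).comp (continuous_single (A := fun _ : Fin 3 => ℝ) a)
      exact h1.comp_aestronglyMeasurable hh.1
    · filter_upwards [hh.2] with x hx
      simpa using hx
  have h1 := hlim' (hH.toLp _)
  have e : inner ℝ N' (hH.toLp _) = ∫ x, h x * N' x a ∂μ := by
    rw [L2.inner_def]
    refine integral_congr_ae ?_
    filter_upwards [hH.coeFn_toLp] with x h2
    rw [h2]
    simp [EuclideanSpace.inner_single_right]
  rw [e] at h1
  refine h1.congr fun k => ?_
  rw [L2.inner_def]
  refine integral_congr_ae ?_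
  filter_upwards [hH.coeFn_toLp, (hn (ns k)).coeFn_toLp] with x h2 h3
  rw [h2, h3]
  simp [EuclideanSpace.inner_single_right]

/-- Summing the squares over the finite index set yields one subsequence that serves all components.
-/
theorem exists_subseq_ae_tendsto {α : Type*} {m : MeasurableSpace α} {μ : Measure α}
    [IsFiniteMeasure μ] {ι : Type*} [Fintype ι] {u : ℕ → ι → α → ℝ} {u' : ι → α → ℝ}
    (hu : ∀ k a, UnitBounded μ (u k a)) (hu' : ∀ a, UnitBounded μ (u' a))
    (h : ∀ a, Tendsto (fun k => ∫ x, (u k a x - u' a x) ^ 2 ∂μ) atTop (𝓝 0)) :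
    ∃ ns : ℕ → ℕ, StrictMono ns ∧
      ∀ᵐ x ∂μ, ∀ a, Tendsto (fun k => u (ns k) a x) atTop (𝓝 (u' a x)) := by
  let f : ℕ → α → ℝ := fun k x => ∑ a, (u k a x - u' a x) ^ 2
  have hi : ∀ k a, Integrable (fun x => (u k a x - u' a x) ^ 2) μ := fun k a => by
    refine Integrable.of_bound (((hu k a).1.sub (hu' a).1).pow 2) 4 ?_
    filter_upwards [(hu k a).2, (hu' a).2] with x h1 h2
    rw [Real.norm_of_nonneg (by exact sq_nonneg _)]
    obtain ⟨h3, h4⟩ := abs_le.1 h1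
    obtain ⟨h5, h6⟩ := abs_le.1 h2
    nlinarith
  have hfi : ∀ k, Integrable (f k) μ := fun k => integrable_finsetSum _ fun a _ => hi k a
  have hf0 : ∀ k x, 0 ≤ f k x := fun k x => Finset.sum_nonneg fun a _ => sq_nonneg _
  have hlim : Tendsto (fun k => ∫ x, f k x ∂μ) atTop (𝓝 0) := by
    have h1 := tendsto_finsetSum Finset.univ fun a _ => h a
    simp only [Finset.sum_const_zero] at h1
    exact h1.congr fun k => (integral_finsetSum _ fun a _ => hi k a).symm
  have hmeas : TendstoInMeasure μ f atTop 0 := by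
    refine tendstoInMeasure_of_tendsto_eLpNorm (p := 1) one_ne_zero (fun k => (hfi k).1)
      aestronglyMeasurable_zero ?_
    have h2 := ENNReal.tendsto_ofReal hlim
    rw [ENNReal.ofReal_zero] at h2
    refine h2.congr fun k => ?_
    rw [sub_zero, eLpNorm_one_eq_lintegral_enorm,
      ofReal_integral_eq_lintegral_ofReal (hfi k) (ae_of_all _ (hf0 k))]
    refine lintegral_congr fun x => ?_
    rw [Real.enorm_eq_ofReal (hf0 k x)]
  obtain ⟨ns, hns, hae⟩ := hmeas.exists_seq_tendsto_ae
  refine ⟨ns, hns, ?_⟩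
  filter_upwards [hae] with x hx a
  have h3 : Tendsto (fun k => (u (ns k) a x - u' a x) ^ 2) atTop (𝓝 0) :=
    squeeze_zero (fun k => sq_nonneg _) (fun k => Finset.single_le_sum
      (f := fun a => (u (ns k) a x - u' a x) ^ 2) (fun a _ => sq_nonneg _) (Finset.mem_univ a)) hx
  have h4 := h3.sqrt
  simp only [Real.sqrt_sq_eq_abs, Real.sqrt_zero] at h4
  exact tendsto_sub_nhds_zero_iff.1 ((tendsto_zero_iff_abs_tendsto_zero _).2 h4)

end Rellich

/-! ### Linearity of weak derivatives, constants and components -/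

section Linear

variable {d : ℕ} {Ω : Set (Eu d)}

theorem IsWeakPartial.add {i : Fin d} {u v f g : Eu d → ℝ} (h : IsWeakPartial Ω i u f)
    (h' : IsWeakPartial Ω i v g) (hu : IntegrableOn u Ω) (hv : IntegrableOn v Ω)
    (hf : IntegrableOn f Ω) (hg : IntegrableOn g Ω) :
    IsWeakPartial Ω i (fun x => u x + v x) (fun x => f x + g x) := by
  intro φ h1 h2 h3
  have hd : Continuous fun x => fderiv ℝ φ x (EuclideanSpace.single i 1) :=
    (h1.continuous_fderiv (by simp)).clm_apply continuous_const
  have hdc : HasCompactSupport fun x => fderiv ℝ φ x (EuclideanSpace.single i 1) :=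
    h2.fderiv_apply (𝕜 := ℝ) _
  have hi : ∀ {ψ w : Eu d → ℝ}, Continuous ψ → HasCompactSupport ψ → IntegrableOn w Ω →
      Integrable (fun x => ψ x • w x) (volume.restrict Ω) := fun hψ hc hw =>
    LocallyIntegrable.integrable_smul_left_of_hasCompactSupport
      (Integrable.locallyIntegrable hw) hψ hc
  simp only [smul_add]
  rw [integral_add (hi hd hdc hu) (hi hd hdc hv),
    integral_add (hi h1.continuous h2 hf) (hi h1.continuous h2 hg), h φ h1 h2 h3, h' φ h1 h2 h3]
  ring

theorem IsWeakPartial.const_mul {i : Fin d} {u f : Eu d → ℝ} (h : IsWeakPartial Ω i u f) (c : ℝ) :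
    IsWeakPartial Ω i (fun x => c * u x) (fun x => c * f x) := by
  intro φ h1 h2 h3
  simp only [smul_eq_mul, mul_left_comm _ c, integral_const_mul]
  have := h φ h1 h2 h3
  simp only [smul_eq_mul] at this
  rw [this]
  ring

theorem isWeakPartial_const (i : Fin d) (c : ℝ) :
    IsWeakPartial Ω i (fun _ => c) (fun _ => (0 : ℝ)) := by
  intro φ h1 h2 h3
  have hd : Continuous fun x => fderiv ℝ φ x (EuclideanSpace.single i 1) :=
    (h1.continuous_fderiv (by simp)).clm_apply continuous_const
  have hdc : HasCompactSupport fun x => fderiv ℝ φ x (EuclideanSpace.single i 1) :=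
    h2.fderiv_apply (𝕜 := ℝ) _
  have e : ∫ x in Ω, fderiv ℝ φ x (EuclideanSpace.single i 1) =
      ∫ x, fderiv ℝ φ x (EuclideanSpace.single i 1) := by
    refine setIntegral_eq_integral_of_forall_compl_eq_zero fun x hx => ?_
    have hx' : x ∉ tsupport (fderiv ℝ φ) := fun h => hx (h3 (tsupport_fderiv_subset ℝ h))
    rw [image_eq_zero_of_notMem_tsupport hx']
    simp
  have h0 := integral_mul_fderiv_eq_neg_fderiv_mul_of_integrable (𝕜 := ℝ) (μ := volume)
    (f := fun _ : Eu d => (1 : ℝ)) (g := φ) (v := EuclideanSpace.single i 1)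
    (by simp) (by simpa using hd.integrable_of_hasCompactSupport hdc)
    (by simpa using h1.continuous.integrable_of_hasCompactSupport h2)
    (fun x _ => differentiableAt_const _) (fun x _ => (h1.differentiable (by simp)) x)
  simp only [one_mul, fderiv_fun_const, Pi.zero_apply, zero_apply, zero_mul, integral_zero,
    neg_zero] at h0
  simp only [smul_eq_mul, integral_mul_const, e, h0, mul_zero, zero_mul, integral_zero, neg_zero]

theorem IsWeakPartial.of_components {i : Fin d} {u g : Eu d → Eu 3} (hu : IntegrableOn u Ω)
    (hg : IntegrableOn g Ω) (h : ∀ a, IsWeakPartial Ω i (fun x => u x a) (fun x => g x a)) :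
    IsWeakPartial Ω i u g := by
  intro φ h1 h2 h3
  have hd : Continuous fun x => fderiv ℝ φ x (EuclideanSpace.single i 1) :=
    (h1.continuous_fderiv (by simp)).clm_apply continuous_const
  have hdc : HasCompactSupport fun x => fderiv ℝ φ x (EuclideanSpace.single i 1) :=
    h2.fderiv_apply (𝕜 := ℝ) _
  have i1 := LocallyIntegrable.integrable_smul_left_of_hasCompactSupport
    (Integrable.locallyIntegrable hu) hd hdc
  have i2 := LocallyIntegrable.integrable_smul_left_of_hasCompactSupport
    (Integrable.locallyIntegrable hg) h1.continuous h2
  ext a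
  rw [PiLp.neg_apply, eval_integral_piLp i1.eval_piLp, eval_integral_piLp i2.eval_piLp]
  exact h a φ h1 h2 h3

end Linear

/-! ### Identifying weak limits and producing test functionals -/

section Limits

variable {α : Type*} {m : MeasurableSpace α} {μ : Measure α}

theorem WeakL1.bdd_mul {g : ℕ → α → ℝ} {g' : α → ℝ} (h : WeakL1 μ g g') {w : α → ℝ}
    (hw : AEStronglyMeasurable w μ) {C : ℝ} (hC : ∀ x, |w x| ≤ C) :
    WeakL1 μ (fun k x => w x * g k x) (fun x => w x * g' x) := by
  intro f hf
  have h1 := h.tendsto_of_bounded (w := fun x => f x * w x) (hf.1.mul hw) (C := C) (by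
    filter_upwards [hf.2] with x hx
    rw [abs_mul]
    exact (mul_le_of_le_one_left (abs_nonneg _) hx).trans (hC x))
  simpa only [mul_assoc] using h1

/-- Dominated convergence shows that the a.e. limit and the weak limit have the same integral over
every measurable set. -/
theorem WeakL1.ae_eq_of_tendsto [IsFiniteMeasure μ] {g : ℕ → α → ℝ} {g' f : α → ℝ}
    (h : WeakL1 μ g g') (hg : ∀ k, AEStronglyMeasurable (g k) μ) (hg' : Integrable g' μ) {C : ℝ}
    (hC : ∀ k, ∀ᵐ x ∂μ, |g k x| ≤ C)
    (hlim : ∀ᵐ x ∂μ, Tendsto (fun k => g k x) atTop (𝓝 (f x))) : g' =ᵐ[μ] f := by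
  have hfm : AEStronglyMeasurable f μ := aestronglyMeasurable_of_tendsto_ae atTop hg hlim
  have hfi : Integrable f μ := by
    refine Integrable.of_bound hfm C ?_
    filter_upwards [hlim, ae_all_iff.2 hC] with x h1 h2
    exact le_of_tendsto' h1.abs h2
  refine hg'.ae_eq_of_forall_setIntegral_eq _ _ hfi fun s hs _ => ?_
  have hind : UnitBounded μ (s.indicator fun _ => (1 : ℝ)) :=
    ⟨aestronglyMeasurable_const.indicator hs, ae_of_all _ fun x => by
      by_cases hx : x ∈ s <;> simp [hx]⟩
  have e : ∀ f : α → ℝ, ∫ x, s.indicator (fun _ => (1 : ℝ)) x * f x ∂μ = ∫ x in s, f x ∂μ := by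
    intro f
    rw [← integral_indicator hs]
    refine integral_congr_ae (ae_of_all _ fun x => ?_)
    by_cases hx : x ∈ s <;> simp [hx]
  have h1 := h _ hind
  simp only [e] at h1
  refine tendsto_nhds_unique h1 (tendsto_integral_of_dominated_convergence (fun _ => C)
    (fun k => (hg k).restrict) (integrable_const _) (fun k => ae_restrict_of_ae (hC k))
    (ae_restrict_of_ae hlim))

/-- On a finite measure space a bounded function lies in the dual exponent space, so Hölder pairing
with it is continuous on `L^p`. This converts weak convergence into `WeakL1`. -/
theorem exists_clm_eq_integral_mul {ι : Type*} [Fintype ι] [DecidableEq ι] [IsFiniteMeasure μ]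
    {p : ℝ≥0∞} [hp : Fact (1 ≤ p)] (a : ι) {h : α → ℝ} (hh : UnitBounded μ h) :
    ∃ L : Lp (EuclideanSpace ℝ ι) p μ →L[ℝ] ℝ, ∀ u, L u = ∫ x, h x * u x a ∂μ := by
  have hq := ENNReal.HolderConjugate.conjExponent hp.out
  have hq' : ENNReal.HolderConjugate (ENNReal.conjExponent p) p := hq.symm
  have : Fact (1 ≤ ENNReal.conjExponent p) := ⟨hq'.one_le⟩
  have hH : MemLp (fun x => (EuclideanSpace.single a (h x) : EuclideanSpace ℝ ι))
      (ENNReal.conjExponent p) μ := by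
    refine MemLp.of_bound ?_ 1 ?_
    · have h1 : Continuous fun t : ℝ => (EuclideanSpace.single a t : EuclideanSpace ℝ ι) :=
        (PiLp.continuous_toLp 2 _).comp (continuous_single (A := fun _ : ι => ℝ) a)
      exact h1.comp_aestronglyMeasurable hh.1
    · filter_upwards [hh.2] with x hx
      simpa using hx
  refine ⟨(innerSL ℝ).lpPairing μ (ENNReal.conjExponent p) p (hH.toLp _), fun u => ?_⟩
  rw [ContinuousLinearMap.lpPairing_eq_integral]
  refine integral_congr_ae ?_
  filter_upwards [hH.coeFn_toLp] with x hx
  change inner ℝ (hH.toLp _ x) (u x) = _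
  rw [hx, EuclideanSpace.inner_single_left]
  simp

end Limits

/-! ### From line fields to directors -/

section Director

variable {d : ℕ} {Ω : Set (Eu d)} {p : ℝ≥0∞} [hp : Fact (1 ≤ p)]

theorem integrableOn_toFun [IsFiniteMeasure (volume.restrict Ω)] {F : Type*}
    [NormedAddCommGroup F] [NormedSpace ℝ F] (U : W1p Ω p F) : IntegrableOn (toFun U) Ω :=
  (Lp.memLp U.1.1).integrable hp.out

theorem integrableOn_partialDeriv [IsFiniteMeasure (volume.restrict Ω)] {F : Type*}
    [NormedAddCommGroup F] [NormedSpace ℝ F] (U : W1p Ω p F) (i : Fin d) :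
    IntegrableOn (partialDeriv U i) Ω :=
  (Lp.memLp (U.1.2 i)).integrable hp.out

theorem isWeakPartial_component [IsFiniteMeasure (volume.restrict Ω)] {ι : Type*} [Fintype ι]
    (U : W1p Ω p (EuclideanSpace ℝ ι)) (i : Fin d) (a : ι) :
    IsWeakPartial Ω i (fun x => toFun U x a) (fun x => partialDeriv U i x a) :=
  IsWeakPartial.clm_comp (U.2 i) (integrableOn_toFun U) (integrableOn_partialDeriv U i)
    (EuclideanSpace.proj a)

theorem projP_apply (s : ℝ) (n : Eu 3) (a b : Fin 3) :
    projP s n a b = s * (n a * n b) + -(s / 3 * if a = b then 1 else 0) := by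
  by_cases h : a = b <;> simp [projP, Matrix.vecMulVec_apply, h]; ring

theorem sum_sq_eq_one_of_mem_sphere2 {n : Eu 3} (h : n ∈ sphere2) :
    n 0 * n 0 + n 1 * n 1 + n 2 * n 2 = 1 := by
  have h1 : ‖n‖ = 1 := by simpa [sphere2] using h
  have h2 := EuclideanSpace.norm_sq_eq n
  rw [h1, Fin.sum_univ_three] at h2
  simp only [Real.norm_eq_abs, sq_abs] at h2
  linarith

theorem abs_apply_le_one_of_mem_sphere2 {n : Eu 3} (h : n ∈ sphere2) (a : Fin 3) : |n a| ≤ 1 := by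
  have h1 : ‖n‖ = 1 := by simpa [sphere2] using h
  rw [← h1]
  exact PiLp.norm_apply_le n a

theorem IsSphereValued.unitBounded {n : W1p Ω p (Eu 3)} (hn : IsSphereValued n) (a : Fin 3) :
    UnitBounded (volume.restrict Ω) (fun x => toFun n x a) := by
  refine ⟨(EuclideanSpace.proj (𝕜 := ℝ) a).continuous.comp_aestronglyMeasurable
    (Lp.aestronglyMeasurable n.1.1), ?_⟩
  filter_upwards [hn] with x hx using abs_apply_le_one_of_mem_sphere2 hx a

/-- The gradient of a director field is determined by that of its line field:
`∂ᵢ n = s⁻¹ (∂ᵢ Q) n`. -/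
theorem partialDeriv_director (hΩ : IsOpen Ω) [IsFiniteMeasure (volume.restrict Ω)] {s : ℝ}
    (hs : s ≠ 0) {Q : W1p Ω p Mat9} {n : W1p Ω p (Eu 3)} (hn : IsSphereValued n)
    (hQ : ∀ᵐ x ∂(volume.restrict Ω), projP s (toFun n x) = asMatrix (toFun Q x))
    (i : Fin d) (a : Fin 3) :
    (fun x => partialDeriv n i x a) =ᵐ[volume.restrict Ω]
      fun x => s⁻¹ * ∑ b, toFun n x b * partialDeriv Q i x (a, b) := by
  have hb := hn.unitBounded
  have hni : ∀ a, IntegrableOn (fun x => partialDeriv n i x a) Ω := fun a =>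
    Integrable.eval_piLp (integrableOn_partialDeriv n i) a
  have hprod := fun a b => IsWeakPartial.mul hΩ (hb a) (hb b) (hni a) (hni b)
    (isWeakPartial_component n i a) (isWeakPartial_component n i b)
  have hpi : ∀ a b, Integrable (fun x => toFun n x a * partialDeriv n i x b +
      toFun n x b * partialDeriv n i x a) (volume.restrict Ω) := fun a b =>
    ((hb a).integrable_mul (hni b)).add ((hb b).integrable_mul (hni a))
  have hui : ∀ a b, Integrable (fun x => toFun n x a * toFun n x b) (volume.restrict Ω) :=
    fun a b => ((hb a).mul (hb b)).integrable
  -- The product rule applied to `Q_ab = s n_a n_b + const`, with uniqueness of weak derivatives.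
  have hQd : ∀ b, (fun x => partialDeriv Q i x (a, b)) =ᵐ[volume.restrict Ω] fun x =>
      s * (toFun n x a * partialDeriv n i x b + toFun n x b * partialDeriv n i x a) + 0 := by
    intro b
    have h1 := ((hprod a b).const_mul s).add
      (isWeakPartial_const (Ω := Ω) i (-(s / 3 * if a = b then 1 else 0)))
      ((hui a b).const_mul s) (integrable_const _) ((hpi a b).const_mul s) (integrable_const _)
    refine (isWeakPartial_component Q i (a, b)).unique hΩ (h1.congr_ae ?_ .rfl)
      (Integrable.eval_piLp (integrableOn_partialDeriv Q i) _)
      (((hpi a b).const_mul s).add (integrable_const _))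
    filter_upwards [hQ] with x hx
    rw [← projP_apply, hx]
    rfl
  -- The derivative of `|n|² = 1`, that is `2 n · ∂ᵢ n = 0`.
  have htr : (fun x => (toFun n x 0 * partialDeriv n i x 0 + toFun n x 0 * partialDeriv n i x 0) +
      (toFun n x 1 * partialDeriv n i x 1 + toFun n x 1 * partialDeriv n i x 1) +
      (toFun n x 2 * partialDeriv n i x 2 + toFun n x 2 * partialDeriv n i x 2))
      =ᵐ[volume.restrict Ω] fun _ => 0 := by
    have h1 := ((hprod 0 0).add (hprod 1 1) (hui 0 0) (hui 1 1) (hpi 0 0) (hpi 1 1)).add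
      (hprod 2 2) ((hui 0 0).add (hui 1 1)) (hui 2 2) ((hpi 0 0).add (hpi 1 1)) (hpi 2 2)
    refine (h1.congr_ae (u' := fun _ => 1) ?_ .rfl).unique hΩ (isWeakPartial_const i 1)
      (((hpi 0 0).add (hpi 1 1)).add (hpi 2 2)) (integrable_const _)
    filter_upwards [hn] with x hx using sum_sq_eq_one_of_mem_sphere2 hx
  filter_upwards [ae_all_iff.2 hQd, htr, hn] with x h1 h2 h3
  have h4 := sum_sq_eq_one_of_mem_sphere2 h3
  simp only [Fin.sum_univ_three, h1]
  field_simp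
  -- The contraction equals `s |n|² ∂ᵢ n_a + s n_a (n · ∂ᵢ n)`; `h4` reduces the first term to `s ∂ᵢ
  -- n_a` and `h2` removes the second.
  linear_combination (-(s * partialDeriv n i x a)) * h4 - s * toFun n x a * h2 / 2

/-- Finite measure makes a bounded function times a basis vector admissible in both settings: as an
integrable test field when `p = ⊤`, and through the Hölder pairing composed with a coordinate
projection of `W1p` otherwise. -/
theorem weakL1_component (p : ℝ≥0∞) [hp : Fact (1 ≤ p)] [IsFiniteMeasure (volume.restrict Ω)]
    {Qk : ℕ → W1p Ω p Mat9} {Q : W1p Ω p Mat9} (hweak : p ≠ ⊤ → WeaklyConverges Qk Q)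
    (hweakStar : p = ⊤ → WeakStarConverges Qk Q) (a : Fin 3 × Fin 3) :
    WeakL1 (volume.restrict Ω) (fun k x => toFun (Qk k) x a) (fun x => toFun Q x a) ∧
    ∀ i, WeakL1 (volume.restrict Ω) (fun k x => partialDeriv (Qk k) i x a)
      (fun x => partialDeriv Q i x a) := by
  by_cases hpt : p = ⊤
  · have hint : ∀ {h : Eu d → ℝ}, UnitBounded (volume.restrict Ω) h →
        Integrable (fun x => (EuclideanSpace.single a (h x) : Mat9)) (volume.restrict Ω) := by
      intro h hh
      refine Integrable.of_bound ?_ 1 ?_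
      · have h1 : Continuous fun t : ℝ => (EuclideanSpace.single a t : Mat9) :=
          (PiLp.continuous_toLp 2 _).comp (continuous_single (A := fun _ => ℝ) a)
        exact h1.comp_aestronglyMeasurable hh.1
      · filter_upwards [hh.2] with x hx
        simpa using hx
    refine ⟨fun h hh => ?_, fun i h hh => ?_⟩
    · simpa [EuclideanSpace.inner_single_left] using (hweakStar hpt _ (hint hh)).1
    · simpa [EuclideanSpace.inner_single_left] using (hweakStar hpt _ (hint hh)).2 i
  · refine ⟨fun h hh => ?_, fun i h hh => ?_⟩
    · obtain ⟨L, hL⟩ := exists_clm_eq_integral_mul (p := p) a hh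
      have h1 := hweak hpt (L.comp ((ContinuousLinearMap.fst ℝ _ _).comp (W1p Ω p Mat9).subtypeL))
      simpa [hL, toFun] using h1
    · obtain ⟨L, hL⟩ := exists_clm_eq_integral_mul (p := p) a hh
      have h1 := hweak hpt (L.comp ((ContinuousLinearMap.proj i).comp
        ((ContinuousLinearMap.snd ℝ _ _).comp (W1p Ω p Mat9).subtypeL)))
      simpa [hL, partialDeriv] using h1

end Director

/-! ### Passing to the limit in the directors -/

section Main

theorem UnitBounded.memLp_mul {d : ℕ} {p : ℝ≥0∞} {μ : Measure (Eu d)} {h g : Eu d → ℝ}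
    (hh : UnitBounded μ h) (hg : MemLp g p μ) : MemLp (fun x => h x * g x) p μ := by
  refine hg.of_le (hh.1.mul hg.1) ?_
  filter_upwards [hh.2] with x hx
  rw [norm_mul]
  exact mul_le_of_le_one_left (norm_nonneg _) hx

variable {d : ℕ} {Ω : Set (Eu d)} {p : ℝ≥0∞} [hp : Fact (1 ≤ p)]

/-- The gradient formula with `|n_b| ≤ 1` carries the eventual `L¹` bounds from the derivatives of
`Qk` to those of the directors. -/
theorem eventually_sum_integral_abs_director_le (hΩ : IsOpen Ω)
    [IsFiniteMeasure (volume.restrict Ω)] {s : ℝ} (hs : s ≠ 0) {Qk : ℕ → W1p Ω p Mat9}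
    {Q : W1p Ω p Mat9} {n : ℕ → W1p Ω p (Eu 3)} (hn : ∀ k, IsSphereValued (n k))
    (hQ : ∀ k, ∀ᵐ x ∂(volume.restrict Ω), projP s (toFun (n k) x) = asMatrix (toFun (Qk k) x))
    (hw : ∀ i c, WeakL1 (volume.restrict Ω) (fun k x => partialDeriv (Qk k) i x c)
      (fun x => partialDeriv Q i x c)) (a : Fin 3) :
    ∃ C : ℝ, ∀ᶠ k in atTop, ∑ i, ∫ x in Ω, |partialDeriv (n k) i x a| ≤ C := by
  have hi : ∀ (U : W1p Ω p Mat9) i c, Integrable (fun x => partialDeriv U i x c)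
      (volume.restrict Ω) := fun U i c => Integrable.eval_piLp (integrableOn_partialDeriv U i) c
  choose C hC using fun i c =>
    (hw i c).eventually_integral_abs_le (fun k => hi (Qk k) i c) (hi Q i c)
  refine ⟨∑ i, |s⁻¹| * ∑ b, C i (a, b), ?_⟩
  filter_upwards [eventually_all.2 fun i => eventually_all.2 fun c => hC i c] with k hk
  refine Finset.sum_le_sum fun i _ => ?_
  have hdi := Integrable.eval_piLp (integrableOn_partialDeriv (n k) i) a
  calc ∫ x in Ω, |partialDeriv (n k) i x a|
      ≤ ∫ x in Ω, |s⁻¹| * ∑ b, |partialDeriv (Qk k) i x (a, b)| := by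
        refine integral_mono_ae hdi.abs
          ((integrable_finsetSum _ fun b _ => (hi (Qk k) i (a, b)).abs).const_mul _) ?_
        filter_upwards [partialDeriv_director hΩ hs (hn k) (hQ k) i a, hn k] with x h1 h2
        rw [h1, abs_mul]
        refine mul_le_mul_of_nonneg_left ((Finset.abs_sum_le_sum_abs _ _).trans
          (Finset.sum_le_sum fun b _ => ?_)) (abs_nonneg _)
        rw [abs_mul]
        exact mul_le_of_le_one_left (abs_nonneg _) (abs_apply_le_one_of_mem_sphere2 h2 b)
    _ = |s⁻¹| * ∑ b, ∫ x in Ω, |partialDeriv (Qk k) i x (a, b)| := by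
        rw [integral_const_mul, integral_finsetSum _ fun b _ => (hi (Qk k) i (a, b)).abs]
    _ ≤ _ := mul_le_mul_of_nonneg_left (Finset.sum_le_sum fun b _ => hk i (a, b)) (abs_nonneg _)

/-- Director fields of a weakly convergent sequence of line fields converge almost everywhere
along a subsequence. -/
theorem exists_director_limit (hΩ : IsOpen Ω)
    [IsFiniteMeasure (volume.restrict Ω)] {s : ℝ} (hs : s ≠ 0) {Qk : ℕ → W1p Ω p Mat9}
    {Q : W1p Ω p Mat9} {n : ℕ → W1p Ω p (Eu 3)} (hn : ∀ k, IsSphereValued (n k))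
    (hQ : ∀ k, ∀ᵐ x ∂(volume.restrict Ω), projP s (toFun (n k) x) = asMatrix (toFun (Qk k) x))
    (hw : ∀ i c, WeakL1 (volume.restrict Ω) (fun k x => partialDeriv (Qk k) i x c)
      (fun x => partialDeriv Q i x c)) :
    ∃ n' : Eu d → Eu 3, ∃ ns : ℕ → ℕ, StrictMono ns ∧ IntegrableOn n' Ω ∧
      (∀ᵐ x ∂(volume.restrict Ω), n' x ∈ sphere2) ∧
      ∀ᵐ x ∂(volume.restrict Ω), ∀ a,
        Tendsto (fun k => toFun (n (ns k)) x a) atTop (𝓝 (n' x a)) := by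
  obtain ⟨n', ns, hns, hni, hweak⟩ := exists_weak_limit (μ := volume.restrict Ω)
    (n := fun k => toFun (n k)) (fun k => Lp.aestronglyMeasurable (n k).1.1) (fun k => by
      filter_upwards [hn k] with x hx
      exact (by simpa [sphere2] using hx : ‖toFun (n k) x‖ = 1).le)
  have hb' : ∀ a, UnitBounded (volume.restrict Ω) fun x => n' x a := fun a =>
    (hweak a).unitBounded (fun k => (hn (ns k)).unitBounded a) (Integrable.eval_piLp hni a)
  have hlim : ∀ a, Tendsto (fun k => ∫ x in Ω, (toFun (n (ns k)) x a - n' x a) ^ 2) atTop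
      (𝓝 0) := by
    intro a
    obtain ⟨C, hC⟩ := eventually_sum_integral_abs_director_le hΩ hs hn hQ hw a
    exact tendsto_setIntegral_sq_sub hΩ (fun k => (hn (ns k)).unitBounded a) (hb' a)
      (fun k i => Integrable.eval_piLp (integrableOn_partialDeriv (n (ns k)) i) a)
      (fun k i => isWeakPartial_component (n (ns k)) i a)
      (hns.tendsto_atTop.eventually hC) (hweak a)
  obtain ⟨ms, hms, hae⟩ := exists_subseq_ae_tendsto
    (u := fun k a x => toFun (n (ns k)) x a) (u' := fun a x => n' x a)
    (fun k a => (hn (ns k)).unitBounded a) hb' hlim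
  refine ⟨n', ns ∘ ms, hns.comp hms, hni, ?_, hae⟩
  -- The unit length constraint is not preserved by weak limits; a.e. convergence is what keeps it.
  filter_upwards [hae, ae_all_iff.2 hn] with x hx h1
  have h2 : Tendsto (fun k => ‖toFun (n (ns (ms k))) x‖) atTop (𝓝 ‖n' x‖) := by
    refine Tendsto.norm ?_
    have h3 := ((PiLp.continuous_toLp 2 (fun _ : Fin 3 => ℝ)).tendsto _).comp
      (tendsto_pi_nhds.2 hx)
    exact h3
  have h4 : ∀ k, ‖toFun (n (ns (ms k))) x‖ = 1 := fun k => by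
    simpa [sphere2] using h1 (ns (ms k))
  simp only [h4] at h2
  simpa [sphere2] using (tendsto_nhds_unique h2 tendsto_const_nhds)

/-- By continuity of `P`, the bounded `Qk` converge a.e. to `P(n')`, and this limit must coincide
with the weak limit `Q`. -/
theorem ae_projP_eq_of_tendsto [IsFiniteMeasure (volume.restrict Ω)] {s : ℝ}
    {Qk : ℕ → W1p Ω p Mat9} {Q : W1p Ω p Mat9} {n : ℕ → W1p Ω p (Eu 3)}
    (hn : ∀ k, IsSphereValued (n k))
    (hQ : ∀ k, ∀ᵐ x ∂(volume.restrict Ω), projP s (toFun (n k) x) = asMatrix (toFun (Qk k) x))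
    (hw : ∀ c, WeakL1 (volume.restrict Ω) (fun k x => toFun (Qk k) x c) (fun x => toFun Q x c))
    {n' : Eu d → Eu 3} (hlim : ∀ᵐ x ∂(volume.restrict Ω), ∀ a,
        Tendsto (fun k => toFun (n k) x a) atTop (𝓝 (n' x a))) :
    ∀ᵐ x ∂(volume.restrict Ω), projP s (n' x) = asMatrix (toFun Q x) := by
  have hcomp : ∀ c : Fin 3 × Fin 3, (fun x => toFun Q x c) =ᵐ[volume.restrict Ω]
      fun x => projP s (n' x) c.1 c.2 := by
    intro c
    have hQc : ∀ k, ∀ᵐ x ∂(volume.restrict Ω),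
        toFun (Qk k) x c = projP s (toFun (n k) x) c.1 c.2 := fun k => by
      filter_upwards [hQ k] with x hx
      rw [hx]
      rfl
    refine (hw c).ae_eq_of_tendsto
      (fun k => (Integrable.eval_piLp (integrableOn_toFun (Qk k)) c).1)
      (Integrable.eval_piLp (integrableOn_toFun Q) c) (C := |s| + |s / 3|) (fun k => ?_) ?_
    · filter_upwards [hQc k, hn k] with x h1 h2
      rw [h1, projP_apply]
      refine (abs_add_le _ _).trans (add_le_add ?_ ?_)
      · rw [abs_mul, abs_mul]
        exact mul_le_of_le_one_right (abs_nonneg _) (mul_le_one₀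
          (abs_apply_le_one_of_mem_sphere2 h2 _) (abs_nonneg _)
          (abs_apply_le_one_of_mem_sphere2 h2 _))
      · rw [abs_neg, abs_mul]
        refine mul_le_of_le_one_right (abs_nonneg _) ?_
        split_ifs <;> simp
    · filter_upwards [hlim, ae_all_iff.2 hQc] with x h1 h2
      simp only [h2, projP_apply]
      exact (((h1 _).mul (h1 _)).const_mul s).add_const _
  filter_upwards [ae_all_iff.2 hcomp] with x hx
  ext a b
  exact (hx (a, b)).symm

/-- The limit is taken in the tested identity `∂ᵢ n_k = s⁻¹ (∂ᵢ Qk) n_k`. The left side converges by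
dominated convergence, the right side by the product lemma, with `φ` absorbed into the weakly
convergent factor. -/
theorem isWeakPartial_director_limit (hΩ : IsOpen Ω)
    [IsFiniteMeasure (volume.restrict Ω)] {s : ℝ} (hs : s ≠ 0) {Qk : ℕ → W1p Ω p Mat9}
    {Q : W1p Ω p Mat9} {n : ℕ → W1p Ω p (Eu 3)} (hn : ∀ k, IsSphereValued (n k))
    (hQ : ∀ k, ∀ᵐ x ∂(volume.restrict Ω), projP s (toFun (n k) x) = asMatrix (toFun (Qk k) x))
    (hw : ∀ i c, WeakL1 (volume.restrict Ω) (fun k x => partialDeriv (Qk k) i x c)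
      (fun x => partialDeriv Q i x c))
    {n' : Eu d → Eu 3} (hn' : ∀ a, UnitBounded (volume.restrict Ω) fun x => n' x a)
    (hlim : ∀ᵐ x ∂(volume.restrict Ω), ∀ a,
        Tendsto (fun k => toFun (n k) x a) atTop (𝓝 (n' x a))) (i : Fin d) (a : Fin 3) :
    IsWeakPartial Ω i (fun x => n' x a)
      (fun x => s⁻¹ * ∑ b, n' x b * partialDeriv Q i x (a, b)) := by
  intro φ h1 h2 h3
  have hi : ∀ (U : W1p Ω p Mat9) c, Integrable (fun x => partialDeriv U i x c)
      (volume.restrict Ω) := fun U c => Integrable.eval_piLp (integrableOn_partialDeriv U i) c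
  obtain ⟨C, hC⟩ := h2.exists_bound_of_continuous h1.continuous
  have hφm : AEStronglyMeasurable φ (volume.restrict Ω) := h1.continuous.aestronglyMeasurable
  have hd : Continuous fun x => fderiv ℝ φ x (EuclideanSpace.single i 1) :=
    (h1.continuous_fderiv (by simp)).clm_apply continuous_const
  have hdc : HasCompactSupport fun x => fderiv ℝ φ x (EuclideanSpace.single i 1) :=
    h2.fderiv_apply (𝕜 := ℝ) _
  have hdi : Integrable (fun x => fderiv ℝ φ x (EuclideanSpace.single i 1))
      (volume.restrict Ω) := (hd.integrable_of_hasCompactSupport hdc).restrict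
  have hφQ : ∀ (U : W1p Ω p Mat9) c, Integrable (fun x => φ x * partialDeriv U i x c)
      (volume.restrict Ω) := fun U c => (hi U c).bdd_mul hφm (ae_of_all _ hC)
  have t1 : Tendsto (fun k => ∫ x in Ω,
      fderiv ℝ φ x (EuclideanSpace.single i 1) • toFun (n k) x a) atTop
      (𝓝 (∫ x in Ω, fderiv ℝ φ x (EuclideanSpace.single i 1) • n' x a)) := by
    refine tendsto_integral_of_dominated_convergence
      (fun x => |fderiv ℝ φ x (EuclideanSpace.single i 1)|)
      (fun k => hdi.1.smul ((hn k).unitBounded a).1) hdi.abs (fun k => ?_) ?_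
    · filter_upwards [((hn k).unitBounded a).2] with x hx
      rw [norm_smul]
      exact mul_le_of_le_one_right (norm_nonneg _) hx
    · filter_upwards [hlim] with x hx
      exact (hx a).const_mul _
  have t2 : Tendsto (fun k => -(s⁻¹ * ∑ b, ∫ x in Ω,
      toFun (n k) x b * (φ x * partialDeriv (Qk k) i x (a, b)))) atTop
      (𝓝 (-(s⁻¹ * ∑ b, ∫ x in Ω, n' x b * (φ x * partialDeriv Q i x (a, b))))) := by
    refine ((tendsto_finsetSum _ fun b _ => ?_).const_mul _).neg
    refine ((hw i (a, b)).bdd_mul hφm hC).tendsto_integral_mul (fun k => hφQ (Qk k) (a, b))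
      (hφQ Q (a, b)) (fun k => (hn k).unitBounded b) (hn' b) ?_
    filter_upwards [hlim] with x hx using hx b
  have e : ∀ (U : W1p Ω p Mat9) {w : Eu d → Eu 3},
      (∀ a, UnitBounded (volume.restrict Ω) fun x => w x a) →
      ∫ x in Ω, φ x • (s⁻¹ * ∑ b, w x b * partialDeriv U i x (a, b)) =
        s⁻¹ * ∑ b, ∫ x in Ω, w x b * (φ x * partialDeriv U i x (a, b)) := by
    intro U w hw
    rw [← integral_finsetSum _ fun b _ => (hw b).integrable_mul (hφQ U (a, b)),
      ← integral_const_mul]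
    refine integral_congr_ae (ae_of_all _ fun x => ?_)
    simp only [smul_eq_mul, Finset.mul_sum]
    exact Finset.sum_congr rfl fun b _ => by ring
  rw [e Q hn']
  refine tendsto_nhds_unique t1 (t2.congr fun k => ?_)
  rw [← e (Qk k) (hn k).unitBounded]
  exact ((isWeakPartial_component (n k) i a).congr_ae .rfl
    (partialDeriv_director hΩ hs (hn k) (hQ k) i a) φ h1 h2 h3).symm

theorem isOrientable_of_weakL1 (hΩ : IsOpen Ω)
    [IsFiniteMeasure (volume.restrict Ω)] {s : ℝ} (hs : s ≠ 0) {Qk : ℕ → W1p Ω p Mat9}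
    {Q : W1p Ω p Mat9} (hor : ∀ k, IsOrientable s (Qk k))
    (hw : ∀ c, WeakL1 (volume.restrict Ω) (fun k x => toFun (Qk k) x c) (fun x => toFun Q x c))
    (hwd : ∀ i c, WeakL1 (volume.restrict Ω) (fun k x => partialDeriv (Qk k) i x c)
      (fun x => partialDeriv Q i x c)) :
    IsOrientable s Q := by
  choose n hn hQ using fun k => (hor k).2
  obtain ⟨n', ns, hns, hni, hsph, hlim⟩ := exists_director_limit hΩ hs hn hQ hwd
  have hP := ae_projP_eq_of_tendsto (fun k => hn (ns k)) (fun k => hQ (ns k))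
    (fun c => (hw c).comp hns) hlim
  have hb : ∀ a, UnitBounded (volume.restrict Ω) fun x => n' x a := fun a =>
    ⟨(Integrable.eval_piLp hni a).1, by
      filter_upwards [hsph] with x hx using abs_apply_le_one_of_mem_sphere2 hx a⟩
  have hnL : MemLp n' p (volume.restrict Ω) := MemLp.of_bound hni.1 1 (by
    filter_upwards [hsph] with x hx
    exact (by simpa [sphere2] using hx : ‖n' x‖ = 1).le)
  -- The gradient of the limit is prescribed by the director formula; it is in `L^p` as a bounded
  -- function times an `L^p` function.
  let D : Fin d → Eu d → Eu 3 := fun i x =>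
    WithLp.toLp 2 fun a => s⁻¹ * ∑ b, n' x b * partialDeriv Q i x (a, b)
  have hDL : ∀ i, MemLp (D i) p (volume.restrict Ω) := fun i => by
    have hterm : ∀ a b, MemLp (fun x => n' x b * partialDeriv Q i x (a, b)) p
        (volume.restrict Ω) := fun a b =>
      (hb b).memLp_mul (MemLp.eval_piLp (Lp.memLp (Q.1.2 i)) (a, b))
    have hsum : ∀ a, MemLp (fun x => ∑ b, n' x b * partialDeriv Q i x (a, b)) p
        (volume.restrict Ω) := fun a => memLp_finsetSum Finset.univ fun b _ => hterm a b
    exact MemLp.of_eval_piLp fun a => (hsum a).const_mul s⁻¹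
  have hD : ∀ i, IsWeakPartial Ω i n' (D i) := fun i =>
    IsWeakPartial.of_components hni ((hDL i).integrable hp.out) fun a =>
      isWeakPartial_director_limit hΩ hs (fun k => hn (ns k)) (fun k => hQ (ns k))
        (fun i c => (hwd i c).comp hns) hb hlim i a
  let N : W1p Ω p (Eu 3) := ⟨(hnL.toLp n', fun i => (hDL i).toLp (D i)), fun i =>
    (hD i).congr_ae hnL.coeFn_toLp.symm (hDL i).coeFn_toLp.symm⟩
  have hN : toFun N =ᵐ[volume.restrict Ω] n' := hnL.coeFn_toLp
  refine ⟨?_, N, ?_, ?_⟩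
  · filter_upwards [hP, hsph] with x h1 h2
    exact ⟨n' x, h2, h1.symm⟩
  · filter_upwards [hN, hsph] with x h1 h2
    rwa [h1]
  · filter_upwards [hN, hP] with x h1 h2
    rwa [h1]

end Main

end LineField

end

theorem mainTheorem7 (d : ℕ) (Ω : Set (LineField.Eu d)) (hopen : IsOpen Ω)
    (hconn : IsConnected Ω) (hbdd : Bornology.IsBounded Ω) (hC0 : LineField.HasC0Boundary Ω)
    (s : ℝ) (hs : s ∈ Set.Icc (-1 / 2 : ℝ) 1) (hs0 : s ≠ 0)
    (p : ENNReal) [Fact (1 ≤ p)]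
    (Qk : ℕ → LineField.W1p Ω p LineField.Mat9) (Q : LineField.W1p Ω p LineField.Mat9)
    (horient : ∀ k, LineField.IsOrientable s (Qk k))
    (hweak : p ≠ ⊤ → LineField.WeaklyConverges Qk Q)
    (hweakStar : p = ⊤ → LineField.WeakStarConverges Qk Q) :
    LineField.IsOrientable s Q := by
  have : IsFiniteMeasure (volume.restrict Ω) :=
    ⟨by rw [Measure.restrict_apply_univ]; exact hbdd.measure_lt_top⟩
  exact LineField.isOrientable_of_weakL1 hopen hs0 horient
    (fun c => (LineField.weakL1_component p hweak hweakStar c).1)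
    (fun i c => (LineField.weakL1_component p hweak hweakStar c).2 i)
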